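/- Let $d\ge 1$ and let $\mathbb{R}^{d+1}$ carry the Minkowski form $\langle x,y\rangle_-=x_1y_1+\cdots+x_dy_d-x_{d+1}y_{d+1}$. Put $\mathcal F=\{x:\langle x,x\rangle_-<0,\ x_{d+1}>0\}$, $\mathbb H^d=\{x:\langle x,x\rangle_-=-1,\ x_{d+1}>0\}$ and $B=\{x:\langle x,x\rangle_-\le -1,\ x_{d+1}>0\}$. Denote by $g,\nabla,\nabla^2$ the Riemannian metric, the gradient and the Hessian of the hyperbolic space $\mathbb H^d$, with $T_\eta\mathbb H^d=\eta^\perp$. An F-convex set is a proper closed convex set $K\subset\mathbb R^{d+1}$ which is an intersection of half-spaces $\{x:\langle x,\eta\rangle_-\le\alpha\}$ with $\eta\in\mathcal F$, $\alpha\in\mathbb R$, and such that for every $\eta\in\mathcal F$ the function $\langle\cdot,\eta\rangle_-$ attains a maximum on $K$. Its support function is $h_K:\mathbb H^d\to\mathbb R$, $h_K(\eta)=\max_{k\in K}\langle k,\eta\rangle_-$. Let $\partial_sK$ be the set of points of $\partial K$ that lie in a space-like support plane of $K$. The (a priori set-valued) Gauss map of $K$ sends $k\in\partial_sK$ to the normals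 $\eta\in\mathbb H^d$ with $\langle k',\eta\rangle_-\le\langle k,\eta\rangle_-$ for all $k'\in K$. The set $K$ is called $C^2_+$ if $\partial_sK$ is a $C^2$ hypersurface and the Gauss map is a (single-valued) $C^1$ diffeomorphism from $\partial_sK$ onto $\mathbb H^d$; the principal curvatures at $k\in\partial_sK$ are then the eigenvalues of the differential of the Gauss map at $k$, seen as an endomorphism of $\eta^\perp$, where $\eta$ is the normal at $k$. For a $C^2$ function $h$ on $\mathbb H^d$ let $H(x)=\|x\|_-\,h(x/\|x\|_-)$ on $\mathcal F$, with $\|x\|_-=\sqrt{-\langle x,x\rangle_-}$, be its $1$-homogeneous extension, and let $\chi(\eta)=\operatorname{grad}_\eta H$ ($\eta\in\mathbb H^d$) be the gradient of $H$ for $\langle\cdot,\cdot\rangle_-$. The principal radii of curvature of $h$ at $\eta$ are the $d$ eigenvalues of the differential of $\chi$ at $\eta$, which is an endomorphism of $T_\eta\mathbb H^d$. Let $K$ be an F-convex set. 1. If $h_K$ is $C^2$, then its principal radii of curvature are real non-negative numbers. 2. If a $C^2$ function $h$ on $\mathbb H^d$ satisfies $\nabla^2h-hg\ge 0$, then it is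 the support function of an F-convex set. 3. If $K$ is $C^2_+$, then $h_K$ is $C^2$ and its principal radii of curvature are positive; at the normal $\eta$ of any $k\in\partial_sK$ they are, with multiplicity, the inverses of the principal curvatures at $k$. 4. If $h_K$ is $C^2$ and its principal radii of curvature are positive, then $K$ is $C^2_+$. 5. If $h_K$ is $C^2$ and $\nabla^2h_K-h_Kg>0$, then $K$ is $C^2_+$. 6. If a $C^2$ function $h$ on $\mathbb H^d$ satisfies $\nabla^2h-hg>0$, then it is the support function of a $C^2_+$ F-convex set. 7. If $h_K$ is $C^2$, then for every $\varepsilon>0$ the set $K+\varepsilon B$ is a $C^2_+$ F-convex set. -/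

import Mathlib

open scoped Pointwise

noncomputable section

namespace FConvex

/-- The vector space `ℝ^{d+1}`. -/
abbrev Mink (d : ℕ) : Type := EuclideanSpace ℝ (Fin (d + 1))

variable {d : ℕ}

/-- The Minkowski form `⟨x, y⟩₋ = x₁ y₁ + ⋯ + x_d y_d - x_{d+1} y_{d+1}`. -/
def mink : Mink d →ₗ[ℝ] Mink d →ₗ[ℝ] ℝ :=
  LinearMap.mk₂ ℝ
    (fun x y => (∑ i : Fin d, x i.castSucc * y i.castSucc) - x (Fin.last d) * y (Fin.last d))
    (by intro x x' y; simp only [PiLp.add_apply, add_mul, Finset.sum_add_distrib]; ring)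
    (by intro c x y; simp only [PiLp.smul_apply, smul_eq_mul, mul_assoc, ← Finset.mul_sum]; ring)
    (by intro x y y'; simp only [PiLp.add_apply, mul_add, Finset.sum_add_distrib]; ring)
    (by intro c x y
        simp only [PiLp.smul_apply, smul_eq_mul, mul_left_comm _ c, ← Finset.mul_sum]; ring)

theorem mink_apply (x y : Mink d) :
    mink x y = (∑ i : Fin d, x i.castSucc * y i.castSucc) - x (Fin.last d) * y (Fin.last d) := rfl

theorem mink_comm (x y : Mink d) : mink x y = mink y x := by
  simp only [mink_apply, mul_comm]

/-- The open cone `𝓕` of future time-like vectors. -/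
def future (d : ℕ) : Set (Mink d) := {x | mink x x < 0 ∧ 0 < x (Fin.last d)}

/-- The hyperbolic space `ℍ^d`, as a pseudo-sphere. -/
def hyp (d : ℕ) : Set (Mink d) := {x | mink x x = -1 ∧ 0 < x (Fin.last d)}

/-- The convex set `B` bounded by `ℍ^d`. -/
def hypBall (d : ℕ) : Set (Mink d) := {x | mink x x ≤ -1 ∧ 0 < x (Fin.last d)}

/-- `‖x‖₋`, for `x` time-like. -/
def lorNorm (x : Mink d) : ℝ := √(-mink x x)

/-- The radial retraction `x ↦ x / ‖x‖₋` of `𝓕` onto `ℍ^d`. -/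
def radial (x : Mink d) : Mink d := (lorNorm x)⁻¹ • x

/-- The `1`-extension to `𝓕` of a function on `ℍ^d`. -/
def oneExt (h : Mink d → ℝ) (x : Mink d) : ℝ := lorNorm x * h (radial x)

/-- The vector that represents a linear form with respect to the Minkowski form. -/
def sharp (L : Mink d →L[ℝ] ℝ) : Mink d :=
  WithLp.toLp 2 fun i =>
    if i = Fin.last d then -L (EuclideanSpace.single i 1) else L (EuclideanSpace.single i 1)

theorem mink_sharp (L : Mink d →L[ℝ] ℝ) (X : Mink d) : mink (sharp L) X = L X := by
  have hX : X = ∑ i, X i • EuclideanSpace.single i (1 : ℝ) := by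
    ext j
    simp [Finset.sum_apply, Pi.single_apply]
  conv_rhs => rw [hX]
  rw [map_sum, Fin.sum_univ_castSucc, mink_apply]
  simp [sharp, Fin.castSucc_ne_last, mul_comm]

/-- The Lorentzian gradient. -/
def lorGrad (f : Mink d → ℝ) (x : Mink d) : Mink d := sharp (fderiv ℝ f x)

/-! ### Calculus on the hyperbolic space

A function on `ℍ^d` is given by a function on `ℝ^{d+1}` of which only the values on `ℍ^d` matter;
it is `C^k` on the submanifold `ℍ^d` if and only if it satisfies `ContDiffOn ℝ k f (hyp d)`.
All the operators below see only the values on `ℍ^d`. -/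

/-- The tangent space `T_η ℍ^d`, for `η ∈ ℍ^d`: the Minkowski orthogonal of `η`. -/
def tangent (η : Mink d) : Submodule ℝ (Mink d) := LinearMap.ker (mink η)

/-- The Minkowski orthogonal projection onto `T_η ℍ^d`. -/
def tangentProj (η : hyp d) : Mink d →ₗ[ℝ] tangent (η : Mink d) :=
  LinearMap.codRestrict (tangent (η : Mink d))
    (LinearMap.id + (mink (η : Mink d)).smulRight (η : Mink d)) (by
      intro v
      have h : mink (η : Mink d) (η : Mink d) = -1 := η.2.1
      simp [tangent, h])

/-- The differential at `η ∈ ℍ^d` of a map `f` on `ℍ^d`: for `X ∈ T_η ℍ^d`, `hypDeriv f η X` is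
the derivative of `f` in the direction `X` (`f` is extended radially, the differential of the
extension vanishes on `η`). -/
def hypDeriv {G : Type*} [NormedAddCommGroup G] [NormedSpace ℝ G] (f : Mink d → G) (η : Mink d) :
    Mink d →L[ℝ] G :=
  fderiv ℝ (fun x => f (radial x)) η

/-- The hyperbolic gradient `∇ h`: the vector of `T_η ℍ^d` with `g(∇ h, X) = dh(X)`. -/
def hypGrad (h : Mink d → ℝ) (η : Mink d) : Mink d := sharp (hypDeriv h η)

/-- The Levi-Civita connection of `ℍ^d` applied to a tangent vector field `V`: the tangential part
of the derivative of `V` in the direction `X`. -/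
def leviCivita (V : Mink d → Mink d) (η : hyp d) (X : tangent (η : Mink d)) :
    tangent (η : Mink d) :=
  tangentProj η (hypDeriv V η X)

/-- The Riemannian metric of `ℍ^d`. -/
def hypMetric (η : hyp d) (X Y : tangent (η : Mink d)) : ℝ := mink (X : Mink d) (Y : Mink d)

/-- The hyperbolic Hessian `∇² h (X, Y) = g(D_X ∇h, Y)`. -/
def hypHess (h : Mink d → ℝ) (η : hyp d) (X Y : tangent (η : Mink d)) : ℝ :=
  hypMetric η (leviCivita (hypGrad h) η X) Y

/-- `∇² h - h g ≥ 0`. -/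
def HessNonneg (h : Mink d → ℝ) : Prop :=
  ∀ (η : hyp d) (X : tangent (η : Mink d)), 0 ≤ hypHess h η X X - h η * hypMetric η X X

/-- `∇² h - h g > 0`. -/
def HessPos (h : Mink d → ℝ) : Prop :=
  ∀ (η : hyp d) (X : tangent (η : Mink d)), X ≠ 0 → 0 < hypHess h η X X - h η * hypMetric η X X

/-! ### F-convex sets -/

/-- F-convex sets. The future side of the space-like hyperplane `⟨x, η⟩₋ = α`, where `η` is future
time-like, is `{x | ⟨x, η⟩₋ ≤ α}`. -/
structure IsFConvex (K : Set (Mink d)) : Prop where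
  isClosed : IsClosed K
  convex : Convex ℝ K
  nonempty : K.Nonempty
  ne_univ : K ≠ Set.univ
  eq_inter : ∃ P : Set (Mink d × ℝ), (∀ p ∈ P, p.1 ∈ future d) ∧
    K = {x | ∀ p ∈ P, mink x p.1 ≤ p.2}
  support : ∀ η ∈ future d, ∃ α : ℝ, (∀ k ∈ K, mink η k ≤ α) ∧ ∃ k ∈ K, mink η k = α

/-- The support function `η ↦ sup {⟨k, η⟩₋ | k ∈ K}`. It is the extended support function on `𝓕`
and the support function `h_K` on `ℍ^d`. -/
def supp (K : Set (Mink d)) (η : Mink d) : ℝ := sSup ((fun k => mink k η) '' K)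

/-- The set-valued Gauss map: the inward unit normals of the space-like support planes of `K`
at `k`. -/
def gaussSet (K : Set (Mink d)) (k : Mink d) : Set (Mink d) :=
  {η | η ∈ hyp d ∧ k ∈ K ∧ ∀ k' ∈ K, mink k' η ≤ mink k η}

/-- `∂_s K`: the points of `∂ K` which are contained in a space-like support plane. -/
def sBoundary (K : Set (Mink d)) : Set (Mink d) :=
  {k | k ∈ frontier K ∧ (gaussSet K k).Nonempty}

open Classical in
/-- The Gauss map on `∂_s K`, meaningful where `gaussSet` is a singleton. -/
def gaussMap (K : Set (Mink d)) (k : Mink d) : Mink d :=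
  if h : (gaussSet K k).Nonempty then h.some else 0

theorem gaussMap_mem_hyp {K : Set (Mink d)} {k : Mink d} (hk : k ∈ sBoundary K) :
    gaussMap K k ∈ hyp d := by
  rw [gaussMap, dif_pos hk.2]
  exact hk.2.some_mem.1

/-- The unit normal at a point of `∂_s K`. -/
def normal (K : Set (Mink d)) (k : sBoundary K) : hyp d := ⟨gaussMap K k, gaussMap_mem_hyp k.2⟩

/-- Embedded hypersurfaces of class `C^n` (`n ≥ 1`): locally the zero set of a `C^n` function with
non-zero differential. -/
def IsHypersurface (n : ℕ) (S : Set (Mink d)) : Prop :=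
  ∀ p ∈ S, ∃ U : Set (Mink d), IsOpen U ∧ p ∈ U ∧ ∃ f : Mink d → ℝ,
    ContDiffOn ℝ n f U ∧ fderiv ℝ f p ≠ 0 ∧ S ∩ U = {x ∈ U | f x = 0}

/-- `K` is `C²₊`: `∂_s K` is `C²` and the Gauss map is a (single-valued) `C¹` diffeomorphism from
`∂_s K` onto `ℍ^d`. -/
structure IsC2Plus (K : Set (Mink d)) : Prop where
  hypersurface : IsHypersurface 2 (sBoundary K)
  singleValued : ∀ k ∈ sBoundary K, (gaussSet K k).Subsingleton
  bijOn : Set.BijOn (gaussMap K) (sBoundary K) (hyp d)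
  contDiffOn : ContDiffOn ℝ 1 (gaussMap K) (sBoundary K)
  contDiffOn_inv : ContDiffOn ℝ 1 (Function.invFunOn (gaussMap K) (sBoundary K)) (hyp d)

/-! ### Radii of curvature and curvatures -/

/-- The normal representation `χ` of a function `h` on `ℍ^d`: the gradient of its `1`-extension. -/
def normalRep (h : Mink d → ℝ) (η : Mink d) : Mink d := lorGrad (oneExt h) η

/-- The reverse shape operator `S⁻¹` at `η`: the differential of `χ`, as an endomorphism of
`T_η ℍ^d`. The differential of `χ` takes its values in `T_η ℍ^d` when `h` is `C²`, so that the
projection is then only a change of codomain. -/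
def reverseShape (h : Mink d → ℝ) (η : hyp d) : Module.End ℝ (tangent (η : Mink d)) :=
  tangentProj η ∘ₗ (hypDeriv (normalRep h) (η : Mink d)).toLinearMap ∘ₗ
    (tangent (η : Mink d)).subtype

/-- The eigenvalues of a real endomorphism, in `ℂ` and with algebraic multiplicity. -/
def complexEigenvalues {V : Type*} [AddCommGroup V] [Module ℝ V] [FiniteDimensional ℝ V]
    (S : Module.End ℝ V) : Multiset ℂ :=
  (S.charpoly.map (algebraMap ℝ ℂ)).roots

/-- The principal radii of curvature of `h` at `η`: the `d` eigenvalues of the reverse shape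
operator. -/
def principalRadii (h : Mink d → ℝ) (η : hyp d) : Multiset ℂ := complexEigenvalues (reverseShape h η)

/-- The shape operator at `k ∈ ∂_s K`: the differential of the Gauss map, where the tangent space
of `∂_s K` at `k` and that of `ℍ^d` at the normal `η` of `k` are both the orthogonal of `η`. The
derivative is taken along `∂_s K`; its restriction to the tangent space of `∂_s K`, which alone is
used here, is then well defined. -/
def shapeOperator (K : Set (Mink d)) (k : sBoundary K) :
    Module.End ℝ (tangent (normal K k : Mink d)) :=
  tangentProj (normal K k) ∘ₗ
    (fderivWithin ℝ (gaussMap K) (sBoundary K) (k : Mink d)).toLinearMap ∘ₗ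
    (tangent (normal K k : Mink d)).subtype

/-- The principal curvatures of `∂_s K` at `k`. -/
def principalCurvatures (K : Set (Mink d)) (k : sBoundary K) : Multiset ℂ :=
  complexEigenvalues (shapeOperator K k)

end FConvex

end

open FConvex

noncomputable section

namespace FConvex

variable {d : ℕ}

/-! ### The Minkowski form -/

/-! Everything is read on the `1`-homogeneous extension `H = oneExt h`, defined on the open convex
cone `future d`. Its gradient χ is constant along rays, so the Hessian of `H` lives on the tangent
spaces of `hyp d`. There it is both the form `∇²h - hg` (`hypHess_sub`) and the form of the reverse
shape operator (`coe_reverseShape`). This operator is thus self-adjoint for a positive definite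
metric, and every sign condition, on the Hessian or on the radii, becomes `TangentNonneg` or
`TangentPos`.

From functions to sets: under `TangentNonneg`, Taylor's formula along segments of the cone gives
⟨χ(x), y⟩ ≤ H(y), with equality at y = x by Euler's relation. So χ(x) lies in `wulff h` and touches
the half-space of normal x. From sets to functions: a point of `K` with normal x is the gradient of
`H` at x as soon as `H` is differentiable there, and adding two support inequalities shows that this
gradient is monotone, which is `TangentNonneg`.

If `K` is C²₊, the inverse Gauss map is C¹ and equals χ, so `H` is C²; shape operator and reverse
shape operator are inverse to each other, hence the radii are non-zero (`IsC2Plus.radii_eq`).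
Conversely, `TangentPos` makes χ injective and immersive on `hyp d`, with image `∂_s K`
(`IsFConvex.isC2Plus`). As χ is only C¹, the C² regularity of its image needs an argument: in normal
coordinates the signed distance to it has gradient minus the unit normal, which is C¹, so that the
distance is C² (`contDiffOn_signedDist`).

Finally, adding `εB` replaces h by h - ε on `hyp d`, which adds `εg` to the Hessian form and makes
it positive. -/

/-- The Minkowski form as a continuous bilinear form. -/
def minkL (d : ℕ) : Mink d →L[ℝ] Mink d →L[ℝ] ℝ :=
  LinearMap.toContinuousLinearMap
    ((LinearMap.toContinuousLinearMap : (Mink d →ₗ[ℝ] ℝ) ≃ₗ[ℝ] _).toLinearMap ∘ₗ mink)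

@[simp] theorem minkL_apply (x y : Mink d) : minkL d x y = mink x y := rfl

theorem sharp_minkL (x : Mink d) : sharp (minkL d x) = x := by
  ext i
  induction i using Fin.lastCases with
  | last => simp [sharp, mink_apply, Fin.castSucc_ne_last]
  | cast i => simp [sharp, mink_apply, Fin.castSucc_ne_last, Fin.castSucc_ne_last i |>.symm]

theorem mink_ext {x y : Mink d} (h : ∀ z, mink x z = mink y z) : x = y := by
  rw [← sharp_minkL x, ← sharp_minkL y]
  congr 1
  ext z
  exact h z

/-- The isomorphism `sharp` as a continuous linear map. -/
def sharpL (d : ℕ) : (Mink d →L[ℝ] ℝ) →L[ℝ] Mink d :=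
  LinearMap.toContinuousLinearMap
    { toFun := sharp
      map_add' := fun L M => mink_ext fun z => by simp [mink_sharp]
      map_smul' := fun c L => mink_ext fun z => by simp [mink_sharp] }

@[simp] theorem sharpL_apply (L : Mink d →L[ℝ] ℝ) : sharpL d L = sharp L := rfl

theorem mink_self (x : Mink d) :
    mink x x = (∑ i : Fin d, x i.castSucc ^ 2) - x (Fin.last d) ^ 2 := by
  simp [mink_apply, sq]

theorem continuous_mink_left (y : Mink d) : Continuous fun x : Mink d => mink x y := by
  have : (fun x : Mink d => mink x y) = minkL d y := by ext x; simp [mink_comm]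
  rw [this]; exact (minkL d y).continuous

theorem contDiff_mink_self {n : WithTop ℕ∞} : ContDiff ℝ n fun x : Mink d => mink x x :=
  (minkL d).contDiff.clm_apply contDiff_id

theorem sum_sq_castSucc_nonneg (x : Mink d) : 0 ≤ ∑ i : Fin d, x i.castSucc ^ 2 :=
  Finset.sum_nonneg fun _ _ => sq_nonneg _

/-- The reversed Cauchy-Schwarz inequality, for vectors in the closed future cone. -/
theorem mink_le_neg_of_sq_le {x y : Mink d} {a b : ℝ}
    (hx : mink x x ≤ -a ^ 2) (hx' : 0 ≤ x (Fin.last d))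
    (hy : mink y y ≤ -b ^ 2) (hy' : 0 ≤ y (Fin.last d)) : mink x y ≤ -(a * b) := by
  rw [mink_self] at hx hy
  rw [mink_apply]
  have hcs := Finset.sum_mul_sq_le_sq_mul_sq Finset.univ
    (fun i : Fin d => x i.castSucc) (fun i : Fin d => y i.castSucc)
  have hX := sum_sq_castSucc_nonneg x
  have hY := sum_sq_castSucc_nonneg y
  set S := ∑ i : Fin d, x i.castSucc * y i.castSucc
  obtain ⟨p, hp, hp'⟩ : ∃ p, 0 ≤ p ∧ p ^ 2 = ∑ i : Fin d, x i.castSucc ^ 2 :=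
    ⟨_, Real.sqrt_nonneg _, Real.sq_sqrt hX⟩
  obtain ⟨q, hq, hq'⟩ : ∃ q, 0 ≤ q ∧ q ^ 2 = ∑ i : Fin d, y i.castSucc ^ 2 :=
    ⟨_, Real.sqrt_nonneg _, Real.sq_sqrt hY⟩
  rw [← hp'] at hx hcs
  rw [← hq'] at hy hcs
  have h1 : S ≤ p * q := by
    apply le_of_sq_le_sq _ (mul_nonneg hp hq)
    rw [mul_pow]; exact hcs
  have h2 : p * q + a * b ≤ x (Fin.last d) * y (Fin.last d) := by
    apply le_of_sq_le_sq _ (mul_nonneg hx' hy')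
    have h3 : (p ^ 2 + a ^ 2) * (q ^ 2 + b ^ 2) ≤ x (Fin.last d) ^ 2 * y (Fin.last d) ^ 2 :=
      mul_le_mul (by linarith) (by linarith) (by positivity) (by positivity)
    -- Lagrange's identity: (p² + a²)(q² + b²) - (pq + ab)² = (pb - aq)².
    nlinarith [sq_nonneg (p * b - a * q)]
  linarith

/-- Cauchy-Schwarz for the spatial parts: orthogonality expresses their product through the last
coordinates, and the spatial part of `x` is strictly shorter than its last coordinate. This makes
the metric of `hyp d` positive definite. -/
theorem mink_self_pos_of_orthogonal {x v : Mink d} (hx : x ∈ future d) (hv : mink x v = 0)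
    (h0 : v ≠ 0) : 0 < mink v v := by
  obtain ⟨hx, hx'⟩ := hx
  rw [mink_self] at hx ⊢
  rw [mink_apply] at hv
  have hcs := Finset.sum_mul_sq_le_sq_mul_sq Finset.univ
    (fun i : Fin d => x i.castSucc) (fun i : Fin d => v i.castSucc)
  have hS : ∑ i : Fin d, x i.castSucc * v i.castSucc = x (Fin.last d) * v (Fin.last d) := by
    linarith
  simp only [hS] at hcs
  have hV := sum_sq_castSucc_nonneg v
  rcases hV.eq_or_lt with h | h
  · exfalso
    rw [← h, mul_zero] at hcs
    have hl : v (Fin.last d) = 0 := by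
      have : x (Fin.last d) * v (Fin.last d) = 0 := by
        apply pow_eq_zero_iff two_ne_zero |>.1; exact le_antisymm hcs (sq_nonneg _)
      exact (mul_eq_zero.1 this).resolve_left hx'.ne'
    have hi := (Finset.sum_eq_zero_iff_of_nonneg (fun i _ => sq_nonneg _)).1 h.symm
    apply h0
    ext i
    induction i using Fin.lastCases with
    | last => exact hl
    | cast i => simpa using hi i (Finset.mem_univ i)
  · have : x (Fin.last d) ^ 2 * v (Fin.last d) ^ 2 <
        x (Fin.last d) ^ 2 * ∑ i : Fin d, v i.castSucc ^ 2 := by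
      rw [← mul_pow]
      exact hcs.trans_lt (mul_lt_mul_of_pos_right (by linarith) h)
    have := lt_of_mul_lt_mul_left this (sq_nonneg _)
    linarith

/-! ### The future cone -/

theorem isOpen_future (d : ℕ) : IsOpen (future d) :=
  (isOpen_lt (contDiff_mink_self (n := 0)).continuous continuous_const).inter
    (isOpen_lt continuous_const (EuclideanSpace.proj (𝕜 := ℝ) (Fin.last d)).continuous)

theorem smul_mem_future {c : ℝ} (hc : 0 < c) {x : Mink d} (hx : x ∈ future d) :
    c • x ∈ future d := by
  refine ⟨?_, by simpa using mul_pos hc hx.2⟩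
  have := mul_pos (mul_pos hc hc) (neg_pos.2 hx.1)
  simp only [map_smul, LinearMap.smul_apply, smul_eq_mul]
  linarith

theorem lorNorm_pos {x : Mink d} (hx : x ∈ future d) : 0 < lorNorm x :=
  Real.sqrt_pos.2 (neg_pos.2 hx.1)

theorem lorNorm_sq {x : Mink d} (hx : x ∈ future d) : lorNorm x ^ 2 = -mink x x :=
  Real.sq_sqrt (neg_pos.2 hx.1).le

theorem mink_le_neg_lorNorm_mul {x y : Mink d} (hx : x ∈ future d) (hy : y ∈ future d) :
    mink x y ≤ -(lorNorm x * lorNorm y) :=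
  mink_le_neg_of_sq_le (by rw [lorNorm_sq hx, neg_neg]) hx.2.le (by rw [lorNorm_sq hy, neg_neg]) hy.2.le

theorem mink_neg_of_future {x y : Mink d} (hx : x ∈ future d) (hy : y ∈ future d) :
    mink x y < 0 :=
  (mink_le_neg_lorNorm_mul hx hy).trans_lt
    (neg_neg_of_pos (mul_pos (lorNorm_pos hx) (lorNorm_pos hy)))

/-- A vector of the closed future cone plus a vector of the open one is in the open one. -/
theorem add_mem_future {x y : Mink d} (hx : mink x x ≤ 0) (hx' : 0 ≤ x (Fin.last d))
    (hy : y ∈ future d) : x + y ∈ future d := by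
  have h := mink_le_neg_of_sq_le (a := 0) (b := 0) (by simpa using hx) hx'
    (by simpa using hy.1.le) hy.2.le
  refine ⟨?_, by simpa using add_pos_of_nonneg_of_pos hx' hy.2⟩
  have := hy.1
  simp only [map_add, LinearMap.add_apply, mink_comm y x]
  linarith

theorem convex_future (d : ℕ) : Convex ℝ (future d) := by
  refine convex_iff_forall_pos.2 fun x hx y hy a b ha hb _ => ?_
  have h := smul_mem_future ha hx
  exact add_mem_future h.1.le h.2.le (smul_mem_future hb hy)

theorem hyp_subset_future : hyp d ⊆ future d := fun x hx => ⟨by rw [hx.1]; norm_num, hx.2⟩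

theorem lorNorm_of_hyp {x : Mink d} (hx : x ∈ hyp d) : lorNorm x = 1 := by
  simp [lorNorm, hx.1]

theorem radial_of_hyp {x : Mink d} (hx : x ∈ hyp d) : radial x = x := by
  simp [radial, lorNorm_of_hyp hx]

theorem lorNorm_smul {c : ℝ} (hc : 0 < c) (x : Mink d) : lorNorm (c • x) = c * lorNorm x := by
  simp only [lorNorm, map_smul, LinearMap.smul_apply, smul_eq_mul]
  rw [show -(c * (c * mink x x)) = c ^ 2 * -mink x x by ring,
    Real.sqrt_mul (sq_nonneg c), Real.sqrt_sq hc.le]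

theorem radial_smul {c : ℝ} (hc : 0 < c) (x : Mink d) : radial (c • x) = radial x := by
  rw [radial, lorNorm_smul hc, smul_smul, radial]
  congr 1
  field_simp

theorem radial_mem_hyp {x : Mink d} (hx : x ∈ future d) : radial x ∈ hyp d := by
  have hN := lorNorm_pos hx
  refine ⟨?_, by simpa [radial] using mul_pos (inv_pos.2 hN) hx.2⟩
  simp only [radial, map_smul, LinearMap.smul_apply, smul_eq_mul]
  have := lorNorm_sq hx
  field_simp
  linarith

theorem lorNorm_smul_radial {x : Mink d} (hx : x ∈ future d) : lorNorm x • radial x = x :=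
  smul_inv_smul₀ (lorNorm_pos hx).ne' x

theorem radial_radial {x : Mink d} (hx : x ∈ future d) : radial (radial x) = radial x :=
  radial_of_hyp (radial_mem_hyp hx)

theorem contDiffOn_lorNorm {n : WithTop ℕ∞} : ContDiffOn ℝ n lorNorm (future d) :=
  contDiff_mink_self.neg.contDiffOn.sqrt fun _ hx => (neg_pos.2 hx.1).ne'

theorem contDiffOn_radial {n : WithTop ℕ∞} : ContDiffOn ℝ n radial (future d) :=
  (contDiffOn_lorNorm.inv fun _ hx => (lorNorm_pos hx).ne').smul contDiffOn_id

theorem hasFDerivAt_lorNorm {x : Mink d} (hx : x ∈ future d) :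
    HasFDerivAt lorNorm (-minkL d (radial x)) x := by
  have h : HasFDerivAt (fun x : Mink d => mink x x) ((2 : ℝ) • minkL d x) x := by
    refine ((minkL d).hasFDerivAt.clm_apply (hasFDerivAt_id x)).congr_fderiv ?_
    ext1 v
    change mink x v + mink v x = (2 : ℝ) • mink x v
    rw [mink_comm v x, two_smul]
  refine (h.neg.sqrt (neg_pos.2 hx.1).ne').congr_fderiv ?_
  ext1 v
  change 1 / (2 * √(-mink x x)) * (-(2 * mink x v)) = -mink ((√(-mink x x))⁻¹ • x) v
  have := (lorNorm_pos hx).ne'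
  rw [lorNorm] at this
  rw [map_smul, LinearMap.smul_apply, smul_eq_mul]
  field_simp

/-- Up to the factor `(lorNorm x)⁻¹`, the differential is the Minkowski projection onto the
orthogonal of `radial x`. -/
theorem hasFDerivAt_radial {x : Mink d} (hx : x ∈ future d) :
    HasFDerivAt radial ((lorNorm x)⁻¹ • (ContinuousLinearMap.id ℝ (Mink d) +
      (minkL d (radial x)).smulRight (radial x))) x := by
  have hN := (lorNorm_pos hx).ne'
  refine (((hasDerivAt_inv hN).comp_hasFDerivAt x (hasFDerivAt_lorNorm hx)).smul
    (hasFDerivAt_id x)).congr_fderiv ?_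
  ext1 v
  change (lorNorm x)⁻¹ • v + (-(lorNorm x ^ 2)⁻¹ * -mink (radial x) v) • x =
    (lorNorm x)⁻¹ • (v + mink (radial x) v • (lorNorm x)⁻¹ • x)
  rw [smul_add, smul_smul, smul_smul]
  congr 2
  field_simp

theorem hasFDerivAt_radial_of_hyp {x : Mink d} (hx : x ∈ hyp d) :
    HasFDerivAt radial (ContinuousLinearMap.id ℝ (Mink d) + (minkL d x).smulRight x) x := by
  have := hasFDerivAt_radial (hyp_subset_future hx)
  rwa [lorNorm_of_hyp hx, radial_of_hyp hx, inv_one, one_smul] at this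

theorem coe_tangentProj (η : hyp d) (v : Mink d) :
    (tangentProj η v : Mink d) = v + mink (η : Mink d) v • (η : Mink d) := rfl

theorem mink_tangentProj (η : hyp d) (v : Mink d) (Y : tangent (η : Mink d)) :
    mink (tangentProj η v : Mink d) (Y : Mink d) = mink v (Y : Mink d) := by
  have hY : mink (η : Mink d) (Y : Mink d) = 0 := Y.2
  simp [coe_tangentProj, hY]

theorem tangentProj_of_mem (η : hyp d) {v : Mink d} (hv : mink (η : Mink d) v = 0) :
    (tangentProj η v : Mink d) = v := by
  simp [coe_tangentProj, hv]

theorem mink_self_pos_of_tangent (η : hyp d) {X : tangent (η : Mink d)} (hX : X ≠ 0) :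
    0 < mink (X : Mink d) (X : Mink d) :=
  mink_self_pos_of_orthogonal (hyp_subset_future η.2) X.2 (by simpa using hX)

/-! ### Eigenvalues of self-adjoint operators -/

theorem complexEigenvalues_of_basis {V : Type*} [AddCommGroup V] [Module ℝ V]
    [FiniteDimensional ℝ V] {ι : Type*} [Fintype ι] (S : Module.End ℝ V) (b : Module.Basis ι ℝ V)
    (l : ι → ℝ) (h : ∀ i, S (b i) = l i • b i) :
    complexEigenvalues S = Finset.univ.val.map fun i => (l i : ℂ) := by
  classical
  have hm : LinearMap.toMatrix b b S = Matrix.diagonal l := by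
    ext i j
    rw [LinearMap.toMatrix_apply, h]
    by_cases hij : i = j
    · subst hij; simp
    · simp [Matrix.diagonal_apply_ne _ hij, Ne.symm hij]
  rw [complexEigenvalues, ← LinearMap.charpoly_toMatrix S b, hm, Matrix.charpoly_diagonal,
    Polynomial.map_prod]
  simp only [Polynomial.map_sub, Polynomial.map_X, Polynomial.map_C]
  rw [← Polynomial.roots_multiset_prod_X_sub_C (Finset.univ.val.map fun i => (l i : ℂ)),
    Multiset.map_map]
  rfl

/-- A self-adjoint operator for a positive definite form has a basis of eigenvectors. -/
theorem exists_eigenbasis {V : Type*} [AddCommGroup V] [Module ℝ V] [FiniteDimensional ℝ V]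
    (B : V →ₗ[ℝ] V →ₗ[ℝ] ℝ) (hB : ∀ x y, B x y = B y x) (hpos : ∀ x, x ≠ 0 → 0 < B x x)
    (S : Module.End ℝ V) (hS : ∀ x y, B (S x) y = B x (S y)) :
    ∃ (b : Module.Basis (Fin (Module.finrank ℝ V)) ℝ V) (l : Fin (Module.finrank ℝ V) → ℝ),
      (∀ i, S (b i) = l i • b i) ∧ (∀ x, B x x = ∑ i, B (b i) x ^ 2) ∧
      ∀ x, B (S x) x = ∑ i, l i * B (b i) x ^ 2 := by
  -- The form `B` is made an inner product, so that the spectral theorem applies.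
  let core : InnerProductSpace.Core ℝ V :=
    { inner := fun x y => B x y
      conj_inner_symm := fun x y => by simp [hB x y]
      re_inner_nonneg := fun x => by
        by_cases hx : x = 0
        · simp [hx]
        · simpa using (hpos x hx).le
      add_left := fun x y z => by simp
      smul_left := fun x y r => by simp
      definite := fun x hx => by
        by_contra h
        exact (hpos x h).ne' hx }
  let : NormedAddCommGroup V := core.toNormedAddCommGroup
  let : InnerProductSpace ℝ V := InnerProductSpace.ofCore core.toCore
  have hsym : LinearMap.IsSymmetric S := fun x y => hS x y
  set b := hsym.eigenvectorBasis rfl with hb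
  have hSb : ∀ i, S (b i) = hsym.eigenvalues rfl i • b i := fun i =>
    hsym.apply_eigenvectorBasis rfl i
  have hsum : ∀ x y, B x y = ∑ i, B x (b i) * B (b i) y := fun x y =>
    (b.sum_inner_mul_inner x y).symm
  refine ⟨b.toBasis, hsym.eigenvalues rfl, fun i => by simpa using hSb i, fun x => ?_, fun x => ?_⟩
  · rw [hsum x x]
    exact Finset.sum_congr rfl fun i _ => by rw [hB x]; simp [sq]
  · rw [hsum (S x) x]
    refine Finset.sum_congr rfl fun i _ => ?_
    rw [hS, hSb, hB x]
    simp only [map_smul, LinearMap.smul_apply, smul_eq_mul, OrthonormalBasis.coe_toBasis]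
    ring

/-! ### The homogeneous extension -/

theorem contDiffOn_comp_radial {h : Mink d → ℝ} (hh : ContDiffOn ℝ 2 h (hyp d)) :
    ContDiffOn ℝ 2 (fun x => h (radial x)) (future d) :=
  hh.comp contDiffOn_radial fun _ hx => radial_mem_hyp hx

theorem contDiffOn_oneExt {h : Mink d → ℝ} (hh : ContDiffOn ℝ 2 h (hyp d)) :
    ContDiffOn ℝ 2 (oneExt h) (future d) :=
  contDiffOn_lorNorm.mul (contDiffOn_comp_radial hh)

theorem oneExt_of_hyp (h : Mink d → ℝ) {x : Mink d} (hx : x ∈ hyp d) : oneExt h x = h x := by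
  rw [oneExt, lorNorm_of_hyp hx, radial_of_hyp hx, one_mul]

/-- Positive homogeneity on the future cone. -/
def IsHomogeneous (H : Mink d → ℝ) : Prop :=
  ∀ x ∈ future d, ∀ c : ℝ, 0 < c → H (c • x) = c * H x

theorem isHomogeneous_oneExt (h : Mink d → ℝ) : IsHomogeneous (oneExt h) := fun x _ c hc => by
  rw [oneExt, lorNorm_smul hc, radial_smul hc, oneExt, mul_assoc]

theorem mink_lorGrad (H : Mink d → ℝ) (x v : Mink d) : mink (lorGrad H x) v = fderiv ℝ H x v :=
  mink_sharp _ _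

theorem future_mem_nhds {x : Mink d} (hx : x ∈ future d) : future d ∈ nhds x :=
  (isOpen_future d).mem_nhds hx

section

variable {H : Mink d → ℝ}

theorem differentiableAt_of_future (hH : ContDiffOn ℝ 2 H (future d)) {x : Mink d}
    (hx : x ∈ future d) : DifferentiableAt ℝ H x :=
  (hH.contDiffAt (future_mem_nhds hx)).differentiableAt (by norm_num)

theorem contDiffOn_fderiv_of_future (hH : ContDiffOn ℝ 2 H (future d)) :
    ContDiffOn ℝ 1 (fderiv ℝ H) (future d) :=
  hH.fderiv_of_isOpen (isOpen_future d) (by norm_num)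

theorem contDiffOn_lorGrad (hH : ContDiffOn ℝ 2 H (future d)) :
    ContDiffOn ℝ 1 (lorGrad H) (future d) :=
  (sharpL d).contDiff.comp_contDiffOn (contDiffOn_fderiv_of_future hH)

theorem hasFDerivAt_lorGrad (hH : ContDiffOn ℝ 2 H (future d)) {x : Mink d}
    (hx : x ∈ future d) : HasFDerivAt (lorGrad H) (fderiv ℝ (lorGrad H) x) x :=
  ((contDiffOn_lorGrad hH).contDiffAt (future_mem_nhds hx)).differentiableAt (by norm_num)
    |>.hasFDerivAt

theorem mink_fderiv_lorGrad (hH : ContDiffOn ℝ 2 H (future d)) {x : Mink d}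
    (hx : x ∈ future d) (v w : Mink d) :
    mink (fderiv ℝ (lorGrad H) x v) w = fderiv ℝ (fderiv ℝ H) x v w := by
  have h1 : DifferentiableAt ℝ (fderiv ℝ H) x :=
    ((contDiffOn_fderiv_of_future hH).contDiffAt (future_mem_nhds hx)).differentiableAt
      (by norm_num)
  have h2 : HasFDerivAt (lorGrad H) ((sharpL d) ∘L fderiv ℝ (fderiv ℝ H) x) x :=
    (sharpL d).hasFDerivAt.comp x h1.hasFDerivAt
  rw [h2.fderiv]
  exact mink_sharp _ _

/-- Schwarz's theorem for `H`; this is the source of the self-adjointness of the reverse shape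
operator. -/
theorem mink_fderiv_lorGrad_comm (hH : ContDiffOn ℝ 2 H (future d)) {x : Mink d}
    (hx : x ∈ future d) (v w : Mink d) :
    mink (fderiv ℝ (lorGrad H) x v) w = mink (fderiv ℝ (lorGrad H) x w) v := by
  rw [mink_fderiv_lorGrad hH hx, mink_fderiv_lorGrad hH hx]
  exact ((hH.contDiffAt (future_mem_nhds hx)).isSymmSndFDerivAt (by simp)).eq v w

theorem lorGrad_smul (hH : ContDiffOn ℝ 2 H (future d)) (hom : IsHomogeneous H) {x : Mink d}
    (hx : x ∈ future d) {c : ℝ} (hc : 0 < c) : lorGrad H (c • x) = lorGrad H x := by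
  have h1 := (differentiableAt_of_future hH (smul_mem_future hc hx)).hasFDerivAt.comp x
    (c • ContinuousLinearMap.id ℝ (Mink d)).hasFDerivAt
  have h2 := ((differentiableAt_of_future hH hx).hasFDerivAt.const_mul c).congr_of_eventuallyEq
    (f₁ := H ∘ (c • ContinuousLinearMap.id ℝ (Mink d)))
    (by filter_upwards [future_mem_nhds hx] with y hy using hom y hy c hc)
  have h3 := h1.unique h2
  refine mink_ext fun z => ?_
  have h4 := congrArg (fun L => L z) h3
  have h5 : fderiv ℝ H (c • x) (c • z) = c * fderiv ℝ H x z := h4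
  rw [map_smul, smul_eq_mul] at h5
  rw [mink_lorGrad, mink_lorGrad]
  exact mul_left_cancel₀ hc.ne' h5

theorem lorGrad_radial (hH : ContDiffOn ℝ 2 H (future d)) (hom : IsHomogeneous H) {x : Mink d}
    (hx : x ∈ future d) : lorGrad H (radial x) = lorGrad H x :=
  lorGrad_smul hH hom hx (inv_pos.2 (lorNorm_pos hx))

/-- Euler's relation. -/
theorem mink_lorGrad_self (hd : DifferentiableOn ℝ H (future d)) (hom : IsHomogeneous H)
    {x : Mink d} (hx : x ∈ future d) : mink (lorGrad H x) x = H x := by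
  have h0 := (hd.differentiableAt (future_mem_nhds hx)).hasFDerivAt
  have h1 : HasDerivAt (fun t : ℝ => H (t • x)) (fderiv ℝ H x x) 1 := by
    have h2 : HasDerivAt (fun t : ℝ => t • x) x 1 := by
      simpa using (hasDerivAt_id (1 : ℝ)).smul_const x
    exact HasFDerivAt.comp_hasDerivAt (1 : ℝ) (by simpa using h0) h2
  have h3 : HasDerivAt (fun t : ℝ => H (t • x)) (H x) 1 := by
    have h4 : HasDerivAt (fun t : ℝ => t * H x) (H x) 1 := by
      simpa using (hasDerivAt_id (1 : ℝ)).mul_const (H x)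
    refine h4.congr_of_eventuallyEq ?_
    filter_upwards [lt_mem_nhds (show (0 : ℝ) < 1 by norm_num)] with t ht using hom x hx t ht
  rw [mink_lorGrad]
  exact h1.unique h3

/-- Chain rule for `lorGrad H ∘ radial`, which is `lorGrad H` on the cone. It brings the Hessian at
any point of the cone back to `hyp d` and to tangential vectors. -/
theorem fderiv_lorGrad_eq (hH : ContDiffOn ℝ 2 H (future d)) (hom : IsHomogeneous H)
    {x : Mink d} (hx : x ∈ future d) (v : Mink d) :
    fderiv ℝ (lorGrad H) x v = (lorNorm x)⁻¹ •
      fderiv ℝ (lorGrad H) (radial x) (v + mink (radial x) v • radial x) := by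
  have h1 := (hasFDerivAt_lorGrad hH (hyp_subset_future (radial_mem_hyp hx))).comp x
    (hasFDerivAt_radial hx)
  have h2 := h1.congr_of_eventuallyEq (f₁ := lorGrad H)
    (by filter_upwards [future_mem_nhds hx] with y hy using (lorGrad_radial hH hom hy).symm)
  rw [h2.fderiv]
  change fderiv ℝ (lorGrad H) (radial x)
    ((lorNorm x)⁻¹ • (v + mink (radial x) v • radial x)) = _
  rw [map_smul]

theorem fderiv_lorGrad_self (hH : ContDiffOn ℝ 2 H (future d)) (hom : IsHomogeneous H)
    {x : Mink d} (hx : x ∈ future d) : fderiv ℝ (lorGrad H) x x = 0 := by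
  have h : x + mink (radial x) x • radial x = 0 := by
    conv_lhs => rw [← lorNorm_smul_radial hx]
    rw [radial_smul (lorNorm_pos hx), radial_radial hx, map_smul, (radial_mem_hyp hx).1]
    simp
  rw [fderiv_lorGrad_eq hH hom hx, h, map_zero, smul_zero]

/-- The value of the Hessian form only depends on the tangential part. -/
theorem mink_fderiv_lorGrad_self (hH : ContDiffOn ℝ 2 H (future d)) (hom : IsHomogeneous H)
    {x : Mink d} (hx : x ∈ future d) (v : Mink d) :
    mink (fderiv ℝ (lorGrad H) x v) v = (lorNorm x)⁻¹ *
      mink (fderiv ℝ (lorGrad H) (radial x) (v + mink (radial x) v • radial x))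
        (v + mink (radial x) v • radial x) := by
  have hr := hyp_subset_future (radial_mem_hyp hx)
  rw [fderiv_lorGrad_eq hH hom hx, map_smul, LinearMap.smul_apply, smul_eq_mul]
  set w := v + mink (radial x) v • radial x with hw
  -- The radial direction is in the kernel, hence by symmetry it is orthogonal to the image.
  have h0 : mink (fderiv ℝ (lorGrad H) (radial x) w) (radial x) = 0 := by
    rw [mink_fderiv_lorGrad_comm hH hr, fderiv_lorGrad_self hH hom hr]
    simp
  have h1 : mink (fderiv ℝ (lorGrad H) (radial x) w) w =
      mink (fderiv ℝ (lorGrad H) (radial x) w) v + mink (radial x) v *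
        mink (fderiv ℝ (lorGrad H) (radial x) w) (radial x) := by
    conv_lhs => rw [hw, map_add, map_smul, ← hw]
    rfl
  rw [h1, h0, mul_zero, add_zero]

theorem mink_radial_tangential {x : Mink d} (hx : x ∈ future d) (v : Mink d) :
    mink (radial x) (v + mink (radial x) v • radial x) = 0 := by
  rw [map_add, map_smul, (radial_mem_hyp hx).1]
  simp

/-- Non-negativity of the Hessian form on the tangent spaces. -/
def TangentNonneg (H : Mink d → ℝ) : Prop :=
  ∀ η ∈ hyp d, ∀ v, mink η v = 0 → 0 ≤ mink (fderiv ℝ (lorGrad H) η v) v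

/-- Positivity of the Hessian form on the tangent spaces. -/
def TangentPos (H : Mink d → ℝ) : Prop :=
  ∀ η ∈ hyp d, ∀ v, mink η v = 0 → v ≠ 0 → 0 < mink (fderiv ℝ (lorGrad H) η v) v

theorem TangentPos.nonneg (h : TangentPos H) : TangentNonneg H := fun η hη v hv => by
  by_cases h0 : v = 0
  · simp [h0]
  · exact (h η hη v hv h0).le

/-- The support function of a set built from `h` is only known to agree with `h` on `hyp d`, hence
its extension on the cone; positivity has to be transferred. -/
theorem TangentPos.congr {H' : Mink d → ℝ} (h : TangentPos H) (heq : Set.EqOn H' H (future d)) :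
    TangentPos H' := fun η hη v hv h0 => by
  have h1 : lorGrad H' =ᶠ[nhds η] lorGrad H := by
    filter_upwards [future_mem_nhds (hyp_subset_future hη)] with x hx
    rw [lorGrad, lorGrad,
      Filter.EventuallyEq.fderiv_eq (Filter.eventuallyEq_of_mem (future_mem_nhds hx) heq)]
  rw [h1.fderiv_eq]
  exact h η hη v hv h0

/-- Taylor's formula with a mean value remainder, for homogeneous functions. -/
theorem exists_taylor_remainder (hH : ContDiffOn ℝ 2 H (future d)) (hom : IsHomogeneous H)
    {x y : Mink d} (hx : x ∈ future d) (hy : y ∈ future d) :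
    ∃ t : ℝ, x + t • (y - x) ∈ future d ∧ ∃ c > 0, H y - mink (lorGrad H x) y =
      c * mink (fderiv ℝ (lorGrad H) (x + t • (y - x)) (y - x)) (y - x) := by
  set v := y - x with hv
  have hmem : ∀ t ∈ Set.Icc (0 : ℝ) 1, x + t • v ∈ future d := fun t ht =>
    (convex_future d).add_smul_sub_mem hx hy ht
  have hline : ∀ t : ℝ, HasDerivAt (fun t : ℝ => x + t • v) v t := fun t => by
    simpa using ((hasDerivAt_id t).smul_const v).const_add x
  have h1 : ∀ t ∈ Set.Icc (0 : ℝ) 1, HasDerivAt (fun t : ℝ => H (x + t • v))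
      (mink (lorGrad H (x + t • v)) v) t := fun t ht => by
    rw [mink_lorGrad]
    exact (differentiableAt_of_future hH (hmem t ht)).hasFDerivAt.comp_hasDerivAt t (hline t)
  have h2 : ∀ t ∈ Set.Icc (0 : ℝ) 1, HasDerivAt (fun t : ℝ => mink (lorGrad H (x + t • v)) v)
      (mink (fderiv ℝ (lorGrad H) (x + t • v) v) v) t := fun t ht => by
    have h3 := (hasFDerivAt_lorGrad hH (hmem t ht)).comp_hasDerivAt t (hline t)
    have h4 := ((minkL d).flip v).hasFDerivAt.comp_hasDerivAt t h3
    exact h4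
  -- The mean value theorem is used twice, for `H` on [0, 1] and then for its derivative on [0, s].
  -- The remainder has the factor s instead of 1/2; only its sign matters.
  obtain ⟨s, hs, hs'⟩ := exists_hasDerivAt_eq_slope (fun t : ℝ => H (x + t • v)) _ zero_lt_one
    (fun t ht => (h1 t ht).continuousAt.continuousWithinAt)
    (fun t ht => h1 t (Set.Ioo_subset_Icc_self ht))
  have hsub : Set.Icc 0 s ⊆ Set.Icc (0 : ℝ) 1 := Set.Icc_subset_Icc_right hs.2.le
  obtain ⟨r, hr, hr'⟩ := exists_hasDerivAt_eq_slope
    (fun t : ℝ => mink (lorGrad H (x + t • v)) v) _ hs.1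
    (fun t ht => (h2 t (hsub ht)).continuousAt.continuousWithinAt)
    (fun t ht => h2 t (hsub (Set.Ioo_subset_Icc_self ht)))
  refine ⟨r, hmem r (hsub (Set.Ioo_subset_Icc_self hr)), s, hs.1, ?_⟩
  rw [hr', sub_zero, mul_div_cancel₀ _ hs.1.ne', hs']
  have hE := mink_lorGrad_self (hH.differentiableOn (by norm_num)) hom hx
  have hxy : x + v = y := by rw [hv]; abel
  have hy2 : mink (lorGrad H x) y = mink (lorGrad H x) x + mink (lorGrad H x) v := by
    rw [← map_add, hxy]
  simp only [one_smul, zero_smul, add_zero, sub_zero, div_one, hxy]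
  rw [hy2, hE]
  ring

/-- Convexity of `H` on the cone: its graph lies above the tangent hyperplane at `x`, which is
linear by Euler's relation. -/
theorem mink_lorGrad_le (hH : ContDiffOn ℝ 2 H (future d)) (hom : IsHomogeneous H)
    (hnn : TangentNonneg H) {x y : Mink d} (hx : x ∈ future d) (hy : y ∈ future d) :
    mink (lorGrad H x) y ≤ H y := by
  obtain ⟨t, hz, c, hc, h⟩ := exists_taylor_remainder hH hom hx hy
  rw [mink_fderiv_lorGrad_self hH hom hz] at h
  have h1 := hnn _ (radial_mem_hyp hz) _ (mink_radial_tangential hz (y - x))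
  have h2 := mul_nonneg hc.le (mul_nonneg (inv_pos.2 (lorNorm_pos hz)).le h1)
  linarith

theorem eq_of_smul_eq_of_hyp {x y : Mink d} (hx : x ∈ hyp d) (hy : y ∈ hyp d) {a b : ℝ}
    (hab : a ≠ 0 ∨ b ≠ 0) (h : a • y = b • x) : y = x := by
  have hxl := hx.2
  have hyl := hy.2
  have hl : a * y (Fin.last d) = b * x (Fin.last d) := by
    simpa using congrArg (fun z : Mink d => z (Fin.last d)) h
  have ha : a ≠ 0 := by
    rintro rfl
    rw [zero_mul, zero_eq_mul] at hl
    simp_all [hxl.ne']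
  have hy' : y = (a⁻¹ * b) • x := by rw [mul_smul, ← h, inv_smul_smul₀ ha]
  have hpos : 0 < a⁻¹ * b := by
    have h1 : y (Fin.last d) = a⁻¹ * b * x (Fin.last d) := by rw [hy']; simp
    rw [h1] at hyl
    exact pos_of_mul_pos_left hyl hxl.le
  rw [← radial_of_hyp hy, hy', radial_smul hpos, radial_of_hyp hx]

theorem mink_lorGrad_lt (hH : ContDiffOn ℝ 2 H (future d)) (hom : IsHomogeneous H)
    (hpos : TangentPos H) {x y : Mink d} (hx : x ∈ hyp d) (hy : y ∈ hyp d) (hxy : y ≠ x) :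
    mink (lorGrad H x) y < H y := by
  obtain ⟨t, hz, c, hc, h⟩ := exists_taylor_remainder hH hom (hyp_subset_future hx)
    (hyp_subset_future hy)
  set z := x + t • (y - x) with hz'
  rw [mink_fderiv_lorGrad_self hH hom hz] at h
  have h0 : y - x + mink (radial z) (y - x) • radial z ≠ 0 := by
    intro h0
    -- The tangential part of y - x at z vanishes only if y - x is proportional to z. As z is on the
    -- line through x and y, this reads (1 + mt) y = (1 - m + mt) x, and proportional points of `hyp
    -- d` coincide.
    obtain ⟨m, hm⟩ : ∃ m : ℝ, y - x + m • z = 0 :=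
      ⟨mink (radial z) (y - x) * (lorNorm z)⁻¹, by rw [mul_smul]; exact h0⟩
    refine hxy (eq_of_smul_eq_of_hyp hx hy (a := 1 + m * t) (b := 1 - m + m * t) ?_ ?_)
    · by_contra! hcon
      have : m = 0 := by linarith
      rw [this] at hcon
      norm_num at hcon
    · rw [← sub_eq_zero, ← hm, hz']
      module
  have h1 := hpos _ (radial_mem_hyp hz) _ (mink_radial_tangential hz (y - x)) h0
  have h2 := mul_pos hc (mul_pos (inv_pos.2 (lorNorm_pos hz)) h1)
  linarith

theorem lorGrad_injOn (hH : ContDiffOn ℝ 2 H (future d)) (hom : IsHomogeneous H)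
    (hpos : TangentPos H) : Set.InjOn (lorGrad H) (hyp d) := by
  intro x hx y hy h
  by_contra hne
  have h1 := mink_lorGrad_lt hH hom hpos hx hy (Ne.symm hne)
  rw [h, mink_lorGrad_self (hH.differentiableOn (by norm_num)) hom (hyp_subset_future hy)] at h1
  exact lt_irrefl _ h1

end

/-! ### The intrinsic Hessian and the reverse shape operator -/

theorem hypDeriv_lorGrad {H : Mink d → ℝ} (hH : ContDiffOn ℝ 2 H (future d))
    (hom : IsHomogeneous H) {η : Mink d} (hη : η ∈ hyp d) :
    hypDeriv (lorGrad H) η = fderiv ℝ (lorGrad H) η := by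
  refine Filter.EventuallyEq.fderiv_eq ?_
  filter_upwards [future_mem_nhds (hyp_subset_future hη)] with y hy using lorGrad_radial hH hom hy

theorem mink_fderiv_lorGrad_normal {H : Mink d → ℝ} (hH : ContDiffOn ℝ 2 H (future d))
    (hom : IsHomogeneous H) {x : Mink d} (hx : x ∈ future d) (v : Mink d) :
    mink x (fderiv ℝ (lorGrad H) x v) = 0 := by
  rw [mink_comm, mink_fderiv_lorGrad_comm hH hx, fderiv_lorGrad_self hH hom hx]
  simp

/-- The differential of χ is already tangent, by symmetry and Euler, so the projection in
`reverseShape` changes nothing. -/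
theorem coe_reverseShape {h : Mink d → ℝ} (hh : ContDiffOn ℝ 2 h (hyp d)) (η : hyp d)
    (X : tangent (η : Mink d)) :
    (reverseShape h η X : Mink d) = fderiv ℝ (lorGrad (oneExt h)) η X := by
  have hH := contDiffOn_oneExt hh
  have hom := isHomogeneous_oneExt h
  have h1 : hypDeriv (normalRep h) (η : Mink d) = fderiv ℝ (lorGrad (oneExt h)) η :=
    hypDeriv_lorGrad hH hom η.2
  change (tangentProj η (hypDeriv (normalRep h) (η : Mink d) X) : Mink d) = _
  rw [h1]
  exact tangentProj_of_mem η (mink_fderiv_lorGrad_normal hH hom (hyp_subset_future η.2) _)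

theorem lorGrad_oneExt {h : Mink d → ℝ} (hh : ContDiffOn ℝ 2 h (hyp d)) {x : Mink d}
    (hx : x ∈ future d) : lorGrad (oneExt h) x =
      lorNorm x • lorGrad (fun y => h (radial y)) x - h (radial x) • radial x := by
  have h1 := (hasFDerivAt_lorNorm hx).mul
    (differentiableAt_of_future (contDiffOn_comp_radial hh) hx).hasFDerivAt
  have h2 : HasFDerivAt (oneExt h) _ x := h1
  refine mink_ext fun z => ?_
  rw [mink_lorGrad, h2.fderiv, map_sub, LinearMap.sub_apply, map_smul, LinearMap.smul_apply,
    mink_lorGrad, map_smul, LinearMap.smul_apply]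
  change lorNorm x * _ + h (radial x) * -mink (radial x) z = _
  rw [smul_eq_mul, smul_eq_mul, mul_neg, ← sub_eq_add_neg]
  rfl

/-- Differentiate `lorGrad_oneExt` at η along X: the derivative of `lorNorm` vanishes on tangent
vectors, multiples of η are orthogonal to Y, and what remains is the tangential derivative of the
gradient of h minus hX. -/
theorem hypHess_sub {h : Mink d → ℝ} (hh : ContDiffOn ℝ 2 h (hyp d)) (η : hyp d)
    (X Y : tangent (η : Mink d)) : hypHess h η X Y - h η * hypMetric η X Y =
      mink (fderiv ℝ (lorGrad (oneExt h)) η X) (Y : Mink d) := by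
  have hf := contDiffOn_comp_radial hh
  have hη := hyp_subset_future η.2
  set g := lorGrad fun y => h (radial y) with hg
  have hX : mink (η : Mink d) (X : Mink d) = 0 := X.2
  have hY : mink (η : Mink d) (Y : Mink d) = 0 := Y.2
  have hrad := radial_of_hyp η.2
  have h1 : hypDeriv (hypGrad h) (η : Mink d) (X : Mink d) = fderiv ℝ g η X := by
    have h2 : HasFDerivAt g (fderiv ℝ g η) (radial η) := by
      rw [hrad]; exact hasFDerivAt_lorGrad hf hη
    have h3 : HasFDerivAt (fun x => hypGrad h (radial x)) _ (η : Mink d) :=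
      h2.comp (η : Mink d) (hasFDerivAt_radial_of_hyp η.2)
    rw [hypDeriv, h3.fderiv]
    change fderiv ℝ g η (X + mink (η : Mink d) (X : Mink d) • (η : Mink d)) = _
    rw [hX, zero_smul, add_zero]
  have h4 := ((hasFDerivAt_lorNorm hη).smul (hasFDerivAt_lorGrad hf hη)).sub
    ((differentiableAt_of_future hf hη).hasFDerivAt.smul (hasFDerivAt_radial_of_hyp η.2))
  have h5 := h4.congr_of_eventuallyEq (f₁ := lorGrad (oneExt h))
    (by filter_upwards [future_mem_nhds hη] with y hy using lorGrad_oneExt hh hy)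
  rw [h5.fderiv, hypHess, hypMetric, leviCivita, mink_tangentProj, h1, hypMetric]
  change _ = mink ((lorNorm (η : Mink d) • fderiv ℝ g η X +
    (-mink (radial (η : Mink d)) (X : Mink d)) • g η) -
    (h (radial η) • ((X : Mink d) + mink (η : Mink d) (X : Mink d) • (η : Mink d)) +
      (fderiv ℝ (fun y => h (radial y)) η X) • radial (η : Mink d))) (Y : Mink d)
  rw [hrad, lorNorm_of_hyp η.2, hX]
  simp [hY]

theorem tangentNonneg_of_hessNonneg {h : Mink d → ℝ} (hh : ContDiffOn ℝ 2 h (hyp d))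
    (hn : HessNonneg h) : TangentNonneg (oneExt h) := fun η hη v hv => by
  rw [← hypHess_sub hh ⟨η, hη⟩ ⟨v, hv⟩ ⟨v, hv⟩]
  exact hn _ _

theorem tangentPos_of_hessPos {h : Mink d → ℝ} (hh : ContDiffOn ℝ 2 h (hyp d))
    (hn : HessPos h) : TangentPos (oneExt h) := fun η hη v hv h0 => by
  rw [← hypHess_sub hh ⟨η, hη⟩ ⟨v, hv⟩ ⟨v, hv⟩]
  exact hn _ _ (fun h => h0 (congrArg Subtype.val h))

/-- The reverse shape operator has an orthonormal eigenbasis. -/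
theorem exists_eigenbasis_reverseShape {h : Mink d → ℝ} (hh : ContDiffOn ℝ 2 h (hyp d))
    (η : hyp d) : ∃ (b : Module.Basis (Fin (Module.finrank ℝ (tangent (η : Mink d)))) ℝ
        (tangent (η : Mink d))) (l : Fin (Module.finrank ℝ (tangent (η : Mink d))) → ℝ),
      (∀ i, reverseShape h η (b i) = l i • b i) ∧
      (∀ X : tangent (η : Mink d),
        mink (X : Mink d) (X : Mink d) = ∑ i, mink (b i : Mink d) (X : Mink d) ^ 2) ∧
      (∀ X : tangent (η : Mink d), mink (fderiv ℝ (lorGrad (oneExt h)) η X) (X : Mink d) =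
        ∑ i, l i * mink (b i : Mink d) (X : Mink d) ^ 2) ∧
      principalRadii h η = Finset.univ.val.map fun i => (l i : ℂ) := by
  have hη := hyp_subset_future η.2
  obtain ⟨b, l, hbl, hB, hQ⟩ := exists_eigenbasis
    (mink.compl₁₂ (tangent (η : Mink d)).subtype (tangent (η : Mink d)).subtype)
    (fun x y => mink_comm _ _) (fun x hx => mink_self_pos_of_tangent η hx) (reverseShape h η)
    (fun x y => by
      change mink (reverseShape h η x : Mink d) (y : Mink d) =
        mink (x : Mink d) (reverseShape h η y : Mink d)
      rw [coe_reverseShape hh, coe_reverseShape hh, mink_comm (x : Mink d),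
        mink_fderiv_lorGrad_comm (contDiffOn_oneExt hh) hη])
  exact ⟨b, l, hbl, hB, fun X => by rw [← coe_reverseShape hh]; exact hQ X,
    complexEigenvalues_of_basis _ b l hbl⟩

theorem mink_reverseShape_eigenvector {h : Mink d → ℝ} (hh : ContDiffOn ℝ 2 h (hyp d))
    {η : hyp d} {X : tangent (η : Mink d)} {l : ℝ} (hX : reverseShape h η X = l • X) :
    mink (fderiv ℝ (lorGrad (oneExt h)) η X) (X : Mink d) = l * mink (X : Mink d) (X : Mink d) := by
  rw [← coe_reverseShape hh, hX]
  simp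

theorem radii_nonneg {h : Mink d → ℝ} (hh : ContDiffOn ℝ 2 h (hyp d))
    (hn : TangentNonneg (oneExt h)) (η : hyp d) :
    ∀ r ∈ principalRadii h η, r.im = 0 ∧ 0 ≤ r.re := by
  obtain ⟨b, l, hbl, -, -, hr⟩ := exists_eigenbasis_reverseShape hh η
  rw [hr]
  intro r hr
  obtain ⟨i, -, rfl⟩ := Multiset.mem_map.1 hr
  refine ⟨Complex.ofReal_im _, ?_⟩
  have h1 := hn η η.2 (b i) (b i).2
  rw [mink_reverseShape_eigenvector hh (hbl i)] at h1
  exact nonneg_of_mul_nonneg_left h1 (mink_self_pos_of_tangent η (b.ne_zero i))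

/-- In an orthonormal eigenbasis the Hessian form is a sum of squares weighted by the radii. -/
theorem tangentPos_of_radii_pos {h : Mink d → ℝ} (hh : ContDiffOn ℝ 2 h (hyp d))
    (hr : ∀ η : hyp d, ∀ r ∈ principalRadii h η, r.im = 0 ∧ 0 < r.re) :
    TangentPos (oneExt h) := by
  intro η hη v hv h0
  obtain ⟨b, l, -, hB, hQ, hl⟩ := exists_eigenbasis_reverseShape hh ⟨η, hη⟩
  have hlpos : ∀ i, 0 < l i := fun i => by
    have := (hr ⟨η, hη⟩ (l i) (by rw [hl]; exact Multiset.mem_map_of_mem _ (Finset.mem_univ i))).2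
    simpa using this
  have h1 : 0 < mink v v := mink_self_pos_of_orthogonal (hyp_subset_future hη) hv h0
  have h2 := hB ⟨v, hv⟩
  have h3 := hQ ⟨v, hv⟩
  dsimp only at h2 h3
  rw [h2] at h1
  rw [h3]
  obtain ⟨i, hi, hi'⟩ := (Finset.sum_pos_iff_of_nonneg fun i _ => sq_nonneg _).1 h1
  exact (Finset.sum_pos_iff_of_nonneg fun i _ => mul_nonneg (hlpos i).le (sq_nonneg _)).2
    ⟨i, hi, mul_pos (hlpos i) hi'⟩

/-! ### Support functions -/

theorem supp_eq_of_forall_le {K : Set (Mink d)} {k x : Mink d} (hk : k ∈ K)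
    (h : ∀ k' ∈ K, mink k' x ≤ mink k x) : supp K x = mink k x :=
  IsGreatest.csSup_eq ⟨⟨k, hk, rfl⟩, by rintro _ ⟨k', hk', rfl⟩; exact h k' hk'⟩

section

variable {K : Set (Mink d)}

theorem IsFConvex.exists_supp (hK : IsFConvex K) {x : Mink d} (hx : x ∈ future d) :
    ∃ k ∈ K, mink k x = supp K x ∧ ∀ k' ∈ K, mink k' x ≤ supp K x := by
  obtain ⟨a, ha, k, hk, rfl⟩ := hK.support x hx
  have h : ∀ k' ∈ K, mink k' x ≤ mink k x := fun k' hk' => by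
    rw [mink_comm k', mink_comm k]; exact ha k' hk'
  rw [supp_eq_of_forall_le hk h]
  exact ⟨k, hk, rfl, h⟩

theorem IsFConvex.le_supp (hK : IsFConvex K) {x k : Mink d} (hx : x ∈ future d) (hk : k ∈ K) :
    mink k x ≤ supp K x :=
  (hK.exists_supp hx).choose_spec.2.2 k hk

theorem IsFConvex.isHomogeneous_supp (hK : IsFConvex K) : IsHomogeneous (supp K) := by
  intro x hx c hc
  obtain ⟨k, hk, h, h'⟩ := hK.exists_supp hx
  rw [← h, supp_eq_of_forall_le hk, map_smul, smul_eq_mul]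
  intro k' hk'
  rw [map_smul, map_smul, h]
  exact smul_le_smul_of_nonneg_left (h' k' hk') hc.le

theorem IsFConvex.oneExt_supp (hK : IsFConvex K) {x : Mink d} (hx : x ∈ future d) :
    oneExt (supp K) x = supp K x := by
  rw [oneExt, ← hK.isHomogeneous_supp _ (hyp_subset_future (radial_mem_hyp hx)) _
    (lorNorm_pos hx), lorNorm_smul_radial hx]

/-- A point of `K` in the support plane of normal `x` is the gradient of the support function. -/
theorem IsFConvex.lorGrad_eq (hK : IsFConvex K) {x k : Mink d} (hx : x ∈ future d) (hk : k ∈ K)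
    (hd : DifferentiableAt ℝ (oneExt (supp K)) x) (h : mink k x = supp K x) :
    lorGrad (oneExt (supp K)) x = k := by
  -- On the cone `H` dominates the linear form of `k`, with equality at `x`.
  have hmin : IsLocalMin (fun y => oneExt (supp K) y - minkL d k y) x := by
    filter_upwards [future_mem_nhds hx] with y hy
    have := hK.le_supp hy hk
    rw [minkL_apply, minkL_apply, h, hK.oneExt_supp hx, hK.oneExt_supp hy]
    linarith
  have h0 := hmin.hasFDerivAt_eq_zero (hd.hasFDerivAt.sub (minkL d k).hasFDerivAt)
  rw [sub_eq_zero] at h0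
  rw [lorGrad, h0, sharp_minkL]

theorem IsFConvex.lorGrad_mem (hK : IsFConvex K) {x : Mink d} (hx : x ∈ future d)
    (hd : DifferentiableAt ℝ (oneExt (supp K)) x) :
    lorGrad (oneExt (supp K)) x ∈ K ∧ mink (lorGrad (oneExt (supp K)) x) x = supp K x := by
  obtain ⟨k, hk, h, -⟩ := hK.exists_supp hx
  rw [hK.lorGrad_eq hx hk hd h]
  exact ⟨hk, h⟩

/-- χ(η) and χ(η + tv) both lie in `K`. Adding the support inequality of each at the normal of the
other gives ⟨χ(η + tv) - χ(η), v⟩ ≥ 0 for t > 0; divide by t and let t tend to 0. -/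
theorem IsFConvex.tangentNonneg (hK : IsFConvex K) (hh : ContDiffOn ℝ 2 (supp K) (hyp d)) :
    TangentNonneg (oneExt (supp K)) := by
  intro η hη v _
  have hH := contDiffOn_oneExt hh
  have hf := hyp_subset_future hη
  set H := oneExt (supp K)
  have hline : HasDerivAt (fun t : ℝ => η + t • v) v 0 := by
    simpa using ((hasDerivAt_id (0 : ℝ)).smul_const v).const_add η
  have h1 : HasDerivAt (fun t : ℝ => mink (lorGrad H (η + t • v)) v)
      (mink (fderiv ℝ (lorGrad H) η v) v) 0 := by
    have h2 : HasFDerivAt (lorGrad H) (fderiv ℝ (lorGrad H) η) (η + (0 : ℝ) • v) := by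
      simpa using hasFDerivAt_lorGrad hH hf
    have h3 := h2.comp_hasDerivAt 0 hline
    have h4 := ((minkL d).flip v).hasFDerivAt.comp_hasDerivAt (0 : ℝ) h3
    exact h4
  refine ge_of_tendsto h1.tendsto_slope_zero_right ?_
  have hnear : ∀ᶠ t : ℝ in nhdsWithin 0 (Set.Ioi 0), η + t • v ∈ future d := by
    refine hline.continuousAt.tendsto.mono_left nhdsWithin_le_nhds ?_
    simpa using future_mem_nhds hf
  filter_upwards [hnear, self_mem_nhdsWithin] with t ht ht0
  have ht0 : 0 < t := ht0
  rw [zero_add, zero_smul, add_zero]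
  obtain ⟨ha, ha'⟩ := hK.lorGrad_mem hf (differentiableAt_of_future hH hf)
  obtain ⟨hb, hb'⟩ := hK.lorGrad_mem ht (differentiableAt_of_future hH ht)
  have h3 := hK.le_supp ht ha
  have h4 := hK.le_supp hf hb
  rw [← hb', map_add, map_add, map_smul, map_smul] at h3
  rw [← ha'] at h4
  have h5 : t * mink (lorGrad H η) v ≤ t * mink (lorGrad H (η + t • v)) v := by
    simp only [smul_eq_mul] at h3
    linarith
  exact mul_nonneg (inv_pos.2 ht0).le (sub_nonneg.2 (le_of_mul_le_mul_left h5 ht0))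

end

/-! ### The set with a given support function -/

theorem single_last_mem_hyp (d : ℕ) : EuclideanSpace.single (Fin.last d) (1 : ℝ) ∈ hyp d := by
  constructor
  · simp [mink_apply, Fin.castSucc_ne_last]
  · simp

/-- The convex set cut out by the half-spaces `⟨x, η⟩₋ ≤ h η`. -/
def wulff (h : Mink d → ℝ) : Set (Mink d) := {x | ∀ η ∈ hyp d, mink x η ≤ h η}

theorem lorGrad_mem_wulff {h : Mink d → ℝ} (hh : ContDiffOn ℝ 2 h (hyp d))
    (hn : TangentNonneg (oneExt h)) {x : Mink d} (hx : x ∈ future d) :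
    lorGrad (oneExt h) x ∈ wulff h := fun η hη => by
  rw [← oneExt_of_hyp h hη]
  exact mink_lorGrad_le (contDiffOn_oneExt hh) (isHomogeneous_oneExt h) hn hx (hyp_subset_future hη)

theorem mink_le_oneExt_of_mem_wulff {h : Mink d → ℝ} {x k : Mink d} (hx : x ∈ future d)
    (hk : k ∈ wulff h) : mink k x ≤ oneExt h x := by
  conv_lhs => rw [← lorNorm_smul_radial hx]
  rw [map_smul]
  exact mul_le_mul_of_nonneg_left (hk _ (radial_mem_hyp hx)) (lorNorm_pos hx).le

theorem mink_lorGrad_oneExt {h : Mink d → ℝ} (hh : ContDiffOn ℝ 2 h (hyp d)) {x : Mink d}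
    (hx : x ∈ future d) : mink (lorGrad (oneExt h) x) x = oneExt h x :=
  mink_lorGrad_self ((contDiffOn_oneExt hh).differentiableOn (by norm_num))
    (isHomogeneous_oneExt h) hx

theorem ne_univ_of_forall_mink_le {K : Set (Mink d)} {η : Mink d} (hη : η ∈ hyp d) {a : ℝ}
    (h : ∀ k ∈ K, mink k η ≤ a) : K ≠ Set.univ := by
  rintro rfl
  have := h (-(a + 1) • η) (Set.mem_univ _)
  rw [map_smul, LinearMap.smul_apply, hη.1, smul_eq_mul] at this
  linarith

/-- Closedness and convexity are automatic for an intersection of half-spaces. The Hessian condition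
serves to place the gradient points in the set: they show that it is non-empty and that each maximum
is attained. -/
theorem isFConvex_wulff {h : Mink d → ℝ} (hh : ContDiffOn ℝ 2 h (hyp d))
    (hn : TangentNonneg (oneExt h)) : IsFConvex (wulff h) where
  isClosed := by
    simp only [wulff, Set.ofPred_forall]
    exact isClosed_biInter fun η _ => isClosed_le (continuous_mink_left η) continuous_const
  convex := by
    simp only [wulff, Set.ofPred_forall]
    exact convex_iInter₂ fun η _ => convex_halfSpace_le ((mink.flip η).isLinear) _
  nonempty := ⟨_, lorGrad_mem_wulff hh hn (hyp_subset_future (single_last_mem_hyp d))⟩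
  ne_univ := ne_univ_of_forall_mink_le (single_last_mem_hyp d)
    fun k hk => hk _ (single_last_mem_hyp d)
  eq_inter := ⟨{p | p.1 ∈ hyp d ∧ p.2 = h p.1}, fun p hp => hyp_subset_future hp.1, by
    ext x
    constructor
    · rintro hx ⟨η, a⟩ ⟨hη, rfl : a = h η⟩
      exact hx η hη
    · exact fun hx η hη => hx (η, h η) ⟨hη, rfl⟩⟩
  support := fun η hη => ⟨oneExt h η,
    fun k hk => by rw [mink_comm]; exact mink_le_oneExt_of_mem_wulff hη hk,
    lorGrad (oneExt h) η, lorGrad_mem_wulff hh hn hη, by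
      rw [mink_comm]; exact mink_lorGrad_oneExt hh hη⟩

theorem supp_wulff {h : Mink d → ℝ} (hh : ContDiffOn ℝ 2 h (hyp d))
    (hn : TangentNonneg (oneExt h)) : Set.EqOn (supp (wulff h)) h (hyp d) := fun η hη => by
  have h1 := mink_lorGrad_oneExt hh (hyp_subset_future hη)
  rw [oneExt_of_hyp h hη] at h1
  rw [supp_eq_of_forall_le (lorGrad_mem_wulff hh hn (hyp_subset_future hη)), h1]
  intro k hk
  rw [h1]
  exact hk η hη

/-! ### Sets of class `C²₊` -/

theorem gaussMap_mem_gaussSet {K : Set (Mink d)} {k : Mink d} (hk : k ∈ sBoundary K) :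
    gaussMap K k ∈ gaussSet K k := by
  rw [gaussMap, dif_pos hk.2]
  exact hk.2.some_mem

section

variable {K : Set (Mink d)}

/-- The point of `K` with a given normal, when the Gauss map is bijective. -/
def gaussInv (K : Set (Mink d)) (x : Mink d) : Mink d :=
  Function.invFunOn (gaussMap K) (sBoundary K) (radial x)

theorem IsC2Plus.gaussInv_mem (hC : IsC2Plus K) {x : Mink d} (hx : x ∈ future d) :
    gaussInv K x ∈ sBoundary K :=
  Function.invFunOn_mem (hC.bijOn.surjOn (radial_mem_hyp hx))

theorem IsC2Plus.gaussMap_gaussInv (hC : IsC2Plus K) {x : Mink d} (hx : x ∈ future d) :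
    gaussMap K (gaussInv K x) = radial x :=
  Function.invFunOn_eq (hC.bijOn.surjOn (radial_mem_hyp hx))

theorem IsC2Plus.contDiffOn_gaussInv (hC : IsC2Plus K) :
    ContDiffOn ℝ 1 (gaussInv K) (future d) :=
  hC.contDiffOn_inv.comp contDiffOn_radial fun _ hx => radial_mem_hyp hx

theorem IsC2Plus.gaussInv_normal (hC : IsC2Plus K) (k : sBoundary K) :
    gaussInv K (normal K k) = k := by
  have hf := hyp_subset_future (normal K k).2
  refine hC.bijOn.injOn (hC.gaussInv_mem hf) k.2 ?_
  rw [hC.gaussMap_gaussInv hf, radial_of_hyp (normal K k).2]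
  rfl

theorem IsC2Plus.mink_gaussInv (hC : IsC2Plus K) {x : Mink d}
    (hx : x ∈ future d) :
    gaussInv K x ∈ K ∧ mink (gaussInv K x) x = oneExt (supp K) x := by
  obtain ⟨-, hk, hmax⟩ := gaussMap_mem_gaussSet (hC.gaussInv_mem hx)
  rw [hC.gaussMap_gaussInv hx] at hmax
  refine ⟨hk, ?_⟩
  rw [oneExt, supp_eq_of_forall_le hk hmax]
  conv_lhs => rw [← lorNorm_smul_radial hx]
  rw [map_smul, smul_eq_mul, lorNorm_smul_radial hx]

/-- With k(x) = `gaussInv K x`, the two support inequalities give 0 ≤ H(y) - H(x) - ⟨k(x), y - x⟩ ≤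
⟨k(y) - k(x), y - x⟩, which is o(‖y - x‖) by continuity of k. -/
theorem IsC2Plus.hasFDerivAt_oneExt (hC : IsC2Plus K) (hK : IsFConvex K) {x : Mink d}
    (hx : x ∈ future d) :
    HasFDerivAt (oneExt (supp K)) (minkL d (gaussInv K x)) x := by
  refine HasFDerivAt.of_isLittleO (Asymptotics.isLittleO_iff.2 fun c hc => ?_)
  have hcont : Filter.Tendsto (fun y => ‖minkL d (gaussInv K y - gaussInv K x)‖) (nhds x)
      (nhds 0) := by
    have h1 : ContinuousAt (gaussInv K) x :=
      hC.contDiffOn_gaussInv.continuousOn.continuousAt (future_mem_nhds hx)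
    have h2 : ContinuousAt (fun y => ‖minkL d (gaussInv K y - gaussInv K x)‖) x :=
      ((minkL d).continuous.continuousAt.comp (h1.sub continuousAt_const)).norm
    simpa [ContinuousAt] using h2
  filter_upwards [hcont.eventually_lt_const hc, future_mem_nhds hx] with y hyc hy
  obtain ⟨hxk, hxe⟩ := hC.mink_gaussInv hx
  obtain ⟨hyk, hye⟩ := hC.mink_gaussInv hy
  have h1 := hK.le_supp hy hxk
  have h2 := hK.le_supp hx hyk
  rw [← hK.oneExt_supp hy] at h1
  rw [← hK.oneExt_supp hx] at h2
  have h3 := (minkL d (gaussInv K y - gaussInv K x)).le_opNorm (y - x)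
  have h4 := mul_le_mul_of_nonneg_right hyc.le (norm_nonneg (y - x))
  refine le_trans ?_ (h3.trans h4)
  rw [Real.norm_of_nonneg, Real.norm_eq_abs]
  · refine le_trans ?_ (le_abs_self _)
    change _ ≤ mink (gaussInv K y - gaussInv K x) (y - x)
    rw [minkL_apply]
    simp only [map_sub, LinearMap.sub_apply]
    linarith
  · simp only [minkL_apply, map_sub]
    linarith

theorem IsC2Plus.lorGrad_eq (hC : IsC2Plus K) (hK : IsFConvex K) {x : Mink d}
    (hx : x ∈ future d) : lorGrad (oneExt (supp K)) x = gaussInv K x := by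
  rw [lorGrad, (hC.hasFDerivAt_oneExt hK hx).fderiv, sharp_minkL]

/-- The differential of `H` is represented by `gaussInv K`, which is C¹: one derivative is gained.
-/
theorem IsC2Plus.contDiffOn_supp (hC : IsC2Plus K) (hK : IsFConvex K) :
    ContDiffOn ℝ 2 (supp K) (hyp d) := by
  have h1 : ContDiffOn ℝ (1 + 1) (oneExt (supp K)) (future d) := by
    refine (contDiffOn_succ_iff_fderiv_of_isOpen (isOpen_future d)).2 ⟨fun x hx =>
      (hC.hasFDerivAt_oneExt hK hx).differentiableAt.differentiableWithinAt, by simp, ?_⟩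
    exact ((minkL d).contDiff.comp_contDiffOn hC.contDiffOn_gaussInv).congr
      fun x hx => (hC.hasFDerivAt_oneExt hK hx).fderiv
  rw [one_add_one_eq_two] at h1
  exact (h1.mono hyp_subset_future).congr fun x hx => (oneExt_of_hyp _ hx).symm

/-- χ maps the cone into `∂_s K` and `gaussMap K ∘ χ = radial`, whose differential at η is the
identity on tangent vectors. The chain rule applies to the derivative within `∂_s K`. -/
theorem IsC2Plus.shapeOperator_reverseShape (hC : IsC2Plus K) (hK : IsFConvex K)
    (k : sBoundary K) (X : tangent (normal K k : Mink d)) :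
    shapeOperator K k (reverseShape (supp K) (normal K k) X) = X := by
  have hh := hC.contDiffOn_supp hK
  have hη := (normal K k).2
  have hf := hyp_subset_future hη
  have hk : lorGrad (oneExt (supp K)) (normal K k) = k := by
    rw [hC.lorGrad_eq hK hf, hC.gaussInv_normal]
  have h1 : HasFDerivWithinAt (gaussMap K) (fderivWithin ℝ (gaussMap K) (sBoundary K) k)
      (sBoundary K) (lorGrad (oneExt (supp K)) (normal K k)) := by
    rw [hk]
    exact (hC.contDiffOn.differentiableOn (by norm_num) k k.2).hasFDerivWithinAt
  have h2 := h1.comp (normal K k : Mink d)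
    (hasFDerivAt_lorGrad (contDiffOn_oneExt hh) hf).hasFDerivWithinAt (s := future d)
    (fun x hx => by rw [hC.lorGrad_eq hK hx]; exact hC.gaussInv_mem hx)
  have h3 := (h2.hasFDerivAt (future_mem_nhds hf)).congr_of_eventuallyEq (f₁ := radial)
    (by filter_upwards [future_mem_nhds hf] with x hx
        rw [Function.comp, hC.lorGrad_eq hK hx, hC.gaussMap_gaussInv hx])
  have h4 := congrArg (fun L => L (X : Mink d)) (h3.unique (hasFDerivAt_radial_of_hyp hη))
  have hX : mink (normal K k : Mink d) (X : Mink d) = 0 := X.2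
  have h5 : fderivWithin ℝ (gaussMap K) (sBoundary K) k
      (fderiv ℝ (lorGrad (oneExt (supp K))) (normal K k) X) = X := by
    refine h4.trans ?_
    change (X : Mink d) + mink (normal K k : Mink d) (X : Mink d) • (normal K k : Mink d) = X
    rw [hX, zero_smul, add_zero]
  apply Subtype.ext
  change (tangentProj (normal K k) (fderivWithin ℝ (gaussMap K) (sBoundary K) k
    (reverseShape (supp K) (normal K k) X : Mink d)) : Mink d) = X
  rw [coe_reverseShape hh, h5, tangentProj_of_mem _ hX]

theorem IsC2Plus.radii_eq (hC : IsC2Plus K) (hK : IsFConvex K) (k : sBoundary K) :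
    (∀ r ∈ principalRadii (supp K) (normal K k), r ≠ 0) ∧
    principalRadii (supp K) (normal K k) =
      (principalCurvatures K k).map (fun c => c⁻¹) := by
  obtain ⟨b, l, hbl, -, -, hr⟩ := exists_eigenbasis_reverseShape (hC.contDiffOn_supp hK)
    (normal K k)
  have h1 : ∀ i, l i • shapeOperator K k (b i) = b i := fun i => by
    rw [← map_smul, ← hbl, hC.shapeOperator_reverseShape hK]
  have h0 : ∀ i, l i ≠ 0 := fun i hi => by
    have := h1 i
    rw [hi, zero_smul] at this
    exact b.ne_zero i this.symm
  have h2 : principalCurvatures K k = Finset.univ.val.map fun i => (((l i)⁻¹ : ℝ) : ℂ) :=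
    complexEigenvalues_of_basis _ b _ fun i => by
      rw [eq_inv_smul_iff₀ (h0 i), h1]
  rw [hr, h2, Multiset.map_map]
  refine ⟨?_, by simp⟩
  intro r hr
  obtain ⟨i, -, rfl⟩ := Multiset.mem_map.1 hr
  exact Complex.ofReal_ne_zero.2 (h0 i)

theorem IsC2Plus.radii_pos (hC : IsC2Plus K) (hK : IsFConvex K) (η : hyp d) :
    ∀ r ∈ principalRadii (supp K) η, r.im = 0 ∧ 0 < r.re := by
  obtain ⟨k, hk, hkη⟩ := hC.bijOn.surjOn η.2
  have hn : normal K ⟨k, hk⟩ = η := Subtype.ext hkη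
  have hh := hC.contDiffOn_supp hK
  intro r hr
  obtain ⟨h1, h2⟩ := radii_nonneg hh (hK.tangentNonneg hh) η r hr
  rw [← hn] at hr
  have h3 := (hC.radii_eq hK ⟨k, hk⟩).1 r hr
  exact ⟨h1, lt_of_le_of_ne h2 fun h => h3 (Complex.ext h.symm h1)⟩

end

/-! ### `C²` support functions with positive Hessian form -/

section

variable {H : Mink d → ℝ}

/-- The map `x ↦ χ(x) + x - x / ‖x‖₋` parametrizes a neighbourhood of the hypersurface
`χ(ℍ^d)` by normal coordinates. -/
theorem exists_normal_chart (hH : ContDiffOn ℝ 2 H (future d)) (hom : IsHomogeneous H)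
    (hpos : TangentPos H) {η : Mink d} (hη : η ∈ hyp d) :
    ∃ (U : Set (Mink d)) (Ψ : Mink d → Mink d), IsOpen U ∧ lorGrad H η ∈ U ∧
      ContDiffOn ℝ 1 Ψ U ∧ ∀ p ∈ U, Ψ p ∈ future d ∧
        lorGrad H (Ψ p) + Ψ p - radial (Ψ p) = p := by
  have hf := hyp_subset_future hη
  set Φ : Mink d → Mink d := fun x => lorGrad H x + x - radial x with hΦ
  have hΦη : Φ η = lorGrad H η := by rw [hΦ]; simp [radial_of_hyp hη]
  set A := fderiv ℝ (lorGrad H) η with hA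
  have hC : ContDiffAt ℝ 1 Φ η :=
    (((contDiffOn_lorGrad hH).contDiffAt (future_mem_nhds hf)).add contDiffAt_id).sub
      (contDiffOn_radial.contDiffAt (future_mem_nhds hf))
  -- The two identity terms cancel. `A` is left on the tangent space, and the extra term takes care
  -- of the direction η, which `A` kills.
  have hD : HasFDerivAt Φ (A - (minkL d η).smulRight η) η := by
    refine (((hasFDerivAt_lorGrad hH hf).add (hasFDerivAt_id η)).sub
      (hasFDerivAt_radial_of_hyp hη)).congr_fderiv ?_
    abel
  have hinj : Function.Injective (A - (minkL d η).smulRight η) := by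
    refine (injective_iff_map_eq_zero _).2 fun v hv => ?_
    have hv : A v - mink η v • η = 0 := hv
    have h1 : mink η v = 0 := by
      have h2 := congrArg (mink η) hv
      rw [map_sub, mink_fderiv_lorGrad_normal hH hom hf, map_smul, hη.1, map_zero] at h2
      simpa using h2
    rw [h1, zero_smul, sub_zero] at hv
    by_contra h0
    have h3 := hpos η hη v h1 h0
    rw [← hA, hv] at h3
    simp at h3
  let L : Mink d ≃L[ℝ] Mink d := (LinearEquiv.ofInjectiveEndo
    (A - (minkL d η).smulRight η).toLinearMap hinj).toContinuousLinearEquiv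
  have hL : HasFDerivAt Φ (L : Mink d →L[ℝ] Mink d) η := hD.congr_fderiv (by ext1 v; rfl)
  set e := hC.toOpenPartialHomeomorph Φ hL (by norm_num) with he
  have hmem : e η ∈ e.target := hC.image_mem_toOpenPartialHomeomorph_target hL (by norm_num)
  have heη : e η = lorGrad H η := hΦη
  have hsymm : ContDiffAt ℝ 1 e.symm (lorGrad H η) := by
    have := hC.to_localInverse hL (by norm_num)
    rwa [hΦη] at this
  have hval : e.symm (lorGrad H η) = η := by
    rw [← heη]
    exact e.left_inv (hC.mem_toOpenPartialHomeomorph_source hL (by norm_num))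
  have hev : ∀ᶠ p in nhds (lorGrad H η), ContDiffAt ℝ 1 e.symm p ∧ e.symm p ∈ future d ∧
      p ∈ e.target := by
    refine (hsymm.eventually (by simp)).and (Filter.Eventually.and ?_ ?_)
    · exact hsymm.continuousAt.eventually (by rw [hval]; exact future_mem_nhds hf)
    · exact e.open_target.mem_nhds (heη ▸ hmem)
  obtain ⟨U, hU, hUo, hηU⟩ := eventually_nhds_iff.1 hev
  exact ⟨U, e.symm, hUo, hηU, fun p hp => (hU p hp).1.contDiffWithinAt,
    fun p hp => ⟨(hU p hp).2.1, e.right_inv (hU p hp).2.2⟩⟩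

/-- The signed distance to the hypersurface `χ(ℍ^d)` is of class `C²`. -/
theorem contDiffOn_signedDist (hH : ContDiffOn ℝ 2 H (future d)) (hom : IsHomogeneous H)
    {U : Set (Mink d)} {Ψ : Mink d → Mink d} (hU : IsOpen U) (hΨ : ContDiffOn ℝ 1 Ψ U)
    (hΦ : ∀ p ∈ U, Ψ p ∈ future d ∧ lorGrad H (Ψ p) + Ψ p - radial (Ψ p) = p) :
    (∀ p ∈ U, HasFDerivAt (fun q => lorNorm (Ψ q) - 1) (-minkL d (radial (Ψ p))) p) ∧
      ContDiffOn ℝ 2 (fun q => lorNorm (Ψ q) - 1) U := by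
  have hpt : ∀ p ∈ U, p = lorGrad H (Ψ p) + (lorNorm (Ψ p) - 1) • radial (Ψ p) := fun p hp => by
    conv_lhs => rw [← (hΦ p hp).2]
    rw [sub_smul, lorNorm_smul_radial (hΦ p hp).1, one_smul, add_sub_assoc]
  have hformula : ∀ p ∈ U, lorNorm (Ψ p) - 1 = H (radial (Ψ p)) - mink p (radial (Ψ p)) := by
    intro p hp
    have hx := (hΦ p hp).1
    have hr := radial_mem_hyp hx
    have h1 : mink p (radial (Ψ p)) = mink (lorGrad H (Ψ p)) (radial (Ψ p)) +
        (lorNorm (Ψ p) - 1) * mink (radial (Ψ p)) (radial (Ψ p)) := by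
      have h2 := congrArg (fun z => mink z (radial (Ψ p))) (hpt p hp)
      simpa only [map_add, map_smul, LinearMap.add_apply, LinearMap.smul_apply, smul_eq_mul]
        using h2
    rw [h1, hr.1, ← lorGrad_radial hH hom hx,
      mink_lorGrad_self (hH.differentiableOn (by norm_num)) hom (hyp_subset_future hr)]
    ring
  have hderiv : ∀ p ∈ U,
      HasFDerivAt (fun q => lorNorm (Ψ q) - 1) (-minkL d (radial (Ψ p))) p := by
    intro p hp
    have hx := (hΦ p hp).1
    have hr := radial_mem_hyp hx
    have h1 : HasFDerivAt Ψ (fderiv ℝ Ψ p) p :=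
      ((hΨ.contDiffAt (hU.mem_nhds hp)).differentiableAt (by norm_num)).hasFDerivAt
    have h2 := (hasFDerivAt_radial hx).comp p h1
    have h3 := (differentiableAt_of_future hH (hyp_subset_future hr)).hasFDerivAt.comp p h2
    have h4 := h3.sub ((minkL d).hasFDerivAt.clm_apply h2)
    have h5 := h4.congr_of_eventuallyEq (f₁ := fun q => lorNorm (Ψ q) - 1)
      (by filter_upwards [hU.mem_nhds hp] with q hq using hformula q hq)
    refine h5.congr_fderiv ?_
    ext1 v
    set w := (lorNorm (Ψ p))⁻¹ • (fderiv ℝ Ψ p v +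
      mink (radial (Ψ p)) (fderiv ℝ Ψ p v) • radial (Ψ p)) with hw
    change fderiv ℝ H (radial (Ψ p)) w - (mink p w + mink v (radial (Ψ p))) =
      -mink (radial (Ψ p)) v
    -- The variation w of the normal is tangent, while p and χ(Ψ p) differ by a multiple of the
    -- normal. So all terms containing w cancel, and the derivative of Ψ disappears.
    have hw0 : mink (radial (Ψ p)) w = 0 := by
      rw [hw, map_smul, mink_radial_tangential hx, smul_zero]
    have h6 : mink p w = mink (lorGrad H (Ψ p)) w := by
      have h7 := congrArg (fun z => mink z w) (hpt p hp)
      simpa only [map_add mink, LinearMap.add_apply, map_smul mink, LinearMap.smul_apply, hw0,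
        smul_zero, add_zero] using h7
    rw [h6, ← mink_lorGrad, lorGrad_radial hH hom hx, mink_comm v]
    ring
  refine ⟨hderiv, ?_⟩
  -- The differential involves Ψ itself and not its derivative, so it is C¹ although Ψ is only C¹.
  have h1 : ContDiffOn ℝ (1 + 1) (fun q => lorNorm (Ψ q) - 1) U := by
    refine (contDiffOn_succ_iff_fderiv_of_isOpen hU).2 ⟨fun p hp =>
      (hderiv p hp).differentiableAt.differentiableWithinAt, by simp, ?_⟩
    have h2 : ContDiffOn ℝ 1 (fun q => radial (Ψ q)) U :=
      contDiffOn_radial.comp hΨ fun p hp => (hΦ p hp).1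
    exact ((minkL d).contDiff.comp_contDiffOn h2).neg.congr fun p hp => (hderiv p hp).fderiv
  rwa [one_add_one_eq_two] at h1

end

section

variable {K : Set (Mink d)}

theorem IsFConvex.mem_gaussSet_iff (hK : IsFConvex K) (hh : ContDiffOn ℝ 2 (supp K) (hyp d))
    {k η : Mink d} : η ∈ gaussSet K k ↔ η ∈ hyp d ∧ lorGrad (oneExt (supp K)) η = k := by
  have hd : ∀ {x}, x ∈ hyp d → DifferentiableAt ℝ (oneExt (supp K)) x := fun hx =>
    differentiableAt_of_future (contDiffOn_oneExt hh) (hyp_subset_future hx)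
  constructor
  · rintro ⟨hη, hk, hmax⟩
    exact ⟨hη, hK.lorGrad_eq (hyp_subset_future hη) hk (hd hη) (supp_eq_of_forall_le hk hmax).symm⟩
  · rintro ⟨hη, rfl⟩
    obtain ⟨h1, h2⟩ := hK.lorGrad_mem (hyp_subset_future hη) (hd hη)
    exact ⟨hη, h1, fun k' hk' => by rw [h2]; exact hK.le_supp (hyp_subset_future hη) hk'⟩

/-- Moving from k by -tη increases ⟨·, η⟩ by t, so that k cannot be interior. -/
theorem gaussSet_subset_frontier {k η : Mink d} (h : η ∈ gaussSet K k) : k ∈ frontier K := by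
  obtain ⟨hη, hk, hmax⟩ := h
  refine ⟨subset_closure hk, fun hint => ?_⟩
  have hcont : Filter.Tendsto (fun t : ℝ => k - t • η) (nhds 0) (nhds k) := by
    have : Continuous fun t : ℝ => k - t • η := by fun_prop
    simpa using this.tendsto 0
  have hev : ∀ᶠ t : ℝ in nhdsWithin 0 (Set.Ioi 0), k - t • η ∈ K :=
    (hcont.eventually (mem_interior_iff_mem_nhds.1 hint)).filter_mono nhdsWithin_le_nhds
  obtain ⟨t, ht, ht0⟩ := (hev.and self_mem_nhdsWithin).exists
  have ht0 : 0 < t := ht0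
  have h1 := hmax _ ht
  rw [map_sub, map_smul, LinearMap.sub_apply, LinearMap.smul_apply, hη.1, smul_eq_mul] at h1
  linarith

theorem IsFConvex.mem_sBoundary_iff (hK : IsFConvex K) (hh : ContDiffOn ℝ 2 (supp K) (hyp d))
    {k : Mink d} : k ∈ sBoundary K ↔ ∃ η ∈ hyp d, lorGrad (oneExt (supp K)) η = k := by
  constructor
  · rintro ⟨-, η, hη⟩
    exact ⟨η, (hK.mem_gaussSet_iff hh).1 hη⟩
  · rintro ⟨η, hη⟩
    have h := (hK.mem_gaussSet_iff hh).2 hη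
    exact ⟨gaussSet_subset_frontier h, η, h⟩

theorem IsFConvex.gaussMap_lorGrad (hK : IsFConvex K) (hh : ContDiffOn ℝ 2 (supp K) (hyp d))
    (hpos : TangentPos (oneExt (supp K))) {η : Mink d} (hη : η ∈ hyp d) :
    gaussMap K (lorGrad (oneExt (supp K)) η) = η := by
  have h1 := gaussMap_mem_gaussSet ((hK.mem_sBoundary_iff hh).2 ⟨η, hη, rfl⟩)
  obtain ⟨h2, h3⟩ := (hK.mem_gaussSet_iff hh).1 h1
  exact lorGrad_injOn (contDiffOn_oneExt hh) (isHomogeneous_oneExt _) hpos h2 hη h3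

/-- In normal coordinates, the space-like boundary is the zero set of the signed distance. -/
theorem IsFConvex.lorNorm_chart (hK : IsFConvex K) (hh : ContDiffOn ℝ 2 (supp K) (hyp d))
    {p x : Mink d} (hx : x ∈ future d)
    (hp : lorGrad (oneExt (supp K)) x + x - radial x = p) (hpK : p ∈ sBoundary K) :
    lorNorm x = 1 ∧ lorGrad (oneExt (supp K)) x = p := by
  have hH := contDiffOn_oneExt hh
  have hr := radial_mem_hyp hx
  have hrf := hyp_subset_future hr
  obtain ⟨η, hη, hηp⟩ := (hK.mem_sBoundary_iff hh).1 hpK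
  have hηf := hyp_subset_future hη
  have hxr : x - radial x = (lorNorm x - 1) • radial x := by
    rw [sub_smul, lorNorm_smul_radial hx, one_smul]
  rw [add_sub_assoc, hxr] at hp
  obtain ⟨h1, h2⟩ := hK.lorGrad_mem hηf (differentiableAt_of_future hH hηf)
  obtain ⟨h3, h4⟩ := hK.lorGrad_mem hrf (differentiableAt_of_future hH hrf)
  rw [lorGrad_radial hH (isHomogeneous_oneExt _) hx] at h3 h4
  -- With s = `lorNorm x - 1`, so that p = χ(x) + s • radial x, the support inequality for p at
  -- `radial x` gives s ≥ 0. The one for χ(x) at the normal η of p gives s⟨radial x, η⟩ ≥ 0, hence s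
  -- ≤ 0.
  have h5 := hK.le_supp hrf h1
  have h6 := hK.le_supp hηf h3
  rw [hηp, ← hp, ← h4, map_add, LinearMap.add_apply, map_smul, LinearMap.smul_apply, hr.1,
    smul_eq_mul] at h5
  rw [← h2, hηp, ← hp, map_add, LinearMap.add_apply, map_smul, LinearMap.smul_apply,
    smul_eq_mul] at h6
  have h7 := mink_neg_of_future hrf hηf
  have h8 : lorNorm x - 1 = 0 := by
    refine le_antisymm ?_ (by linarith)
    by_contra! hcon
    have := mul_neg_of_pos_of_neg hcon h7
    linarith
  rw [h8, zero_smul, add_zero] at hp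
  exact ⟨by linarith, hp⟩

theorem mem_hyp_of_lorNorm_eq_one {x : Mink d} (hx : x ∈ future d) (h : lorNorm x = 1) :
    x ∈ hyp d := by
  refine ⟨?_, hx.2⟩
  have := lorNorm_sq hx
  rw [h] at this
  linarith

/-- `∂_s K` is χ(`hyp d`), and `gaussMap K` inverts χ there. In a normal chart the hypersurface is
the zero set of the signed distance, and the Gauss map is the restriction of the C¹ map Ψ. -/
theorem IsFConvex.isC2Plus (hK : IsFConvex K) (hh : ContDiffOn ℝ 2 (supp K) (hyp d))
    (hpos : TangentPos (oneExt (supp K))) : IsC2Plus K := by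
  have hH := contDiffOn_oneExt hh
  have hom := isHomogeneous_oneExt (supp K)
  have hbij : Set.BijOn (gaussMap K) (sBoundary K) (hyp d) := by
    refine ⟨fun k hk => gaussMap_mem_hyp hk, fun k hk k' hk' h => ?_, fun η hη => ?_⟩
    · obtain ⟨η, hη, rfl⟩ := (hK.mem_sBoundary_iff hh).1 hk
      obtain ⟨η', hη', rfl⟩ := (hK.mem_sBoundary_iff hh).1 hk'
      rw [hK.gaussMap_lorGrad hh hpos hη, hK.gaussMap_lorGrad hh hpos hη'] at h
      rw [h]
    · exact ⟨_, (hK.mem_sBoundary_iff hh).2 ⟨η, hη, rfl⟩, hK.gaussMap_lorGrad hh hpos hη⟩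
  refine ⟨?_, ?_, hbij, ?_, ?_⟩
  · intro k hk
    obtain ⟨η, hη, rfl⟩ := (hK.mem_sBoundary_iff hh).1 hk
    obtain ⟨U, Ψ, hU, hkU, hΨ, hΦ⟩ := exists_normal_chart hH hom hpos hη
    obtain ⟨h1, h2⟩ := contDiffOn_signedDist hH hom hU hΨ hΦ
    refine ⟨U, hU, hkU, fun q => lorNorm (Ψ q) - 1, h2, fun h0 => ?_, ?_⟩
    · have hr := radial_mem_hyp (hΦ _ hkU).1
      have h3 := congrArg (fun L => L (radial (Ψ (lorGrad (oneExt (supp K)) η))))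
        ((h1 _ hkU).fderiv.symm.trans h0)
      have h4 : -mink _ _ = (0 : ℝ) := h3
      rw [hr.1] at h4
      norm_num at h4
    · ext p
      constructor
      · rintro ⟨hp, hpU⟩
        obtain ⟨hx, hxp⟩ := hΦ p hpU
        exact ⟨hpU, sub_eq_zero.2 (hK.lorNorm_chart hh hx hxp hp).1⟩
      · rintro ⟨hpU, hp⟩
        obtain ⟨hx, hxp⟩ := hΦ p hpU
        have hy := mem_hyp_of_lorNorm_eq_one hx (sub_eq_zero.1 hp)
        rw [radial_of_hyp hy, add_sub_cancel_right] at hxp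
        exact ⟨(hK.mem_sBoundary_iff hh).2 ⟨_, hy, hxp⟩, hpU⟩
  · intro k _ η hη η' hη'
    rw [hK.mem_gaussSet_iff hh] at hη hη'
    exact lorGrad_injOn hH hom hpos hη.1 hη'.1 (hη.2.trans hη'.2.symm)
  · intro k hk
    obtain ⟨η, hη, rfl⟩ := (hK.mem_sBoundary_iff hh).1 hk
    obtain ⟨U, Ψ, hU, hkU, hΨ, hΦ⟩ := exists_normal_chart hH hom hpos hη
    have heq : ∀ p ∈ sBoundary K ∩ U, gaussMap K p = Ψ p := by
      rintro p ⟨hp, hpU⟩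
      obtain ⟨hx, hxp⟩ := hΦ p hpU
      obtain ⟨h1, h2⟩ := hK.lorNorm_chart hh hx hxp hp
      conv_lhs => rw [← h2]
      exact hK.gaussMap_lorGrad hh hpos (mem_hyp_of_lorNorm_eq_one hx h1)
    refine ((hΨ.contDiffAt (hU.mem_nhds hkU)).contDiffWithinAt).congr_of_eventuallyEq ?_
      (heq _ ⟨hk, hkU⟩)
    filter_upwards [self_mem_nhdsWithin, mem_nhdsWithin_of_mem_nhds (hU.mem_nhds hkU)]
      with p hp hpU using heq p ⟨hp, hpU⟩
  · refine ((contDiffOn_lorGrad hH).mono hyp_subset_future).congr fun η hη => ?_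
    have hm := hbij.surjOn hη
    refine hbij.injOn (Function.invFunOn_mem hm) ((hK.mem_sBoundary_iff hh).2 ⟨η, hη, rfl⟩) ?_
    rw [Function.invFunOn_eq hm, hK.gaussMap_lorGrad hh hpos hη]

end

/-! ### Sums with multiples of `B` -/

/-- The dual of the closed future cone is contained in it. -/
theorem mem_closed_cone_of_dual {v : Mink d}
    (h : ∀ c : Mink d, mink c c ≤ 0 → 0 ≤ c (Fin.last d) → mink v c ≤ 0) :
    mink v v ≤ 0 ∧ 0 ≤ v (Fin.last d) := by
  set e : Mink d := EuclideanSpace.single (Fin.last d) (1 : ℝ) with he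
  have hee : mink e e = -1 := (single_last_mem_hyp d).1
  have hve : mink v e = -v (Fin.last d) := by simp [he, mink_apply, Fin.castSucc_ne_last]
  have hel : e (Fin.last d) = 1 := by simp [he]
  have hl : 0 ≤ v (Fin.last d) := by
    have := h e (by rw [hee]; norm_num) (by rw [hel]; norm_num)
    rw [hve] at this
    linarith
  refine ⟨?_, hl⟩
  obtain ⟨r, hr, hr'⟩ : ∃ r, 0 ≤ r ∧ r ^ 2 = ∑ i : Fin d, v i.castSucc ^ 2 :=
    ⟨_, Real.sqrt_nonneg _, Real.sq_sqrt (sum_sq_castSucc_nonneg v)⟩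
  have hvv : mink v v = r ^ 2 - v (Fin.last d) ^ 2 := by rw [mink_self, hr']
  -- The test vector is v with its last coordinate replaced by the length r of its spatial part: it
  -- is light-like and future.
  have h1 : mink v (v + (r - v (Fin.last d)) • e) = r * (r - v (Fin.last d)) := by
    rw [map_add, map_smul, hvv, hve, smul_eq_mul]; ring
  have h2 : mink (v + (r - v (Fin.last d)) • e) (v + (r - v (Fin.last d)) • e) = 0 := by
    rw [map_add mink, LinearMap.add_apply, h1, map_smul mink, LinearMap.smul_apply, map_add,
      map_smul, mink_comm e v, hve, hee, smul_eq_mul, smul_eq_mul]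
    ring
  have h3 := h (v + (r - v (Fin.last d)) • e) h2.le (by simpa [hel] using hr)
  rw [h1] at h3
  have h4 : r ≤ v (Fin.last d) := by
    by_contra! hcon
    have := mul_pos (hl.trans_lt hcon) (sub_pos.2 hcon)
    linarith
  rw [hvv]
  nlinarith

/-- A closed convex set which is stable under addition of future vectors and has a support plane
in every space-like direction is F-convex. -/
theorem isFConvex_of_stable {S : Set (Mink d)} (hcl : IsClosed S) (hcv : Convex ℝ S)
    (hne : S.Nonempty)
    (hst : ∀ a ∈ S, ∀ c : Mink d, mink c c ≤ 0 → 0 ≤ c (Fin.last d) → a + c ∈ S)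
    (hmax : ∀ x ∈ future d, ∃ k ∈ S, ∀ k' ∈ S, mink k' x ≤ mink k x) : IsFConvex S where
  isClosed := hcl
  convex := hcv
  nonempty := hne
  ne_univ := by
    obtain ⟨k, -, h⟩ := hmax _ (hyp_subset_future (single_last_mem_hyp d))
    exact ne_univ_of_forall_mink_le (single_last_mem_hyp d) h
  support := fun η hη => by
    obtain ⟨k, hk, h⟩ := hmax η hη
    exact ⟨mink η k, fun k' hk' => by rw [mink_comm η, mink_comm η]; exact h k' hk', k, hk, rfl⟩
  eq_inter := by
    refine ⟨{q | q.1 ∈ future d ∧ ∀ k ∈ S, mink k q.1 ≤ q.2}, fun q hq => hq.1, ?_⟩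
    refine Set.Subset.antisymm (fun k hk q hq => hq.2 k hk) fun p hp => ?_
    by_contra hpS
    -- The vector `sharp f` of a separating form is in the closed future cone by stability of `S`,
    -- but it may fail to be time-like. It is then tilted by a small multiple of `e`.
    obtain ⟨f, u, hfS, hfp⟩ := geometric_hahn_banach_closed_point hcv hcl hpS
    obtain ⟨a, ha⟩ := hne
    have hfc : ∀ c : Mink d, mink c c ≤ 0 → 0 ≤ c (Fin.last d) → mink (sharp f) c ≤ 0 := by
      intro c hc hc'
      rw [mink_sharp]
      by_contra! hcon
      have hua := sub_pos.2 (hfS a ha)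
      -- Chosen so that f(a + tc) = u, against the strict bound on `S`.
      set t := (u - f a) / f c with ht
      have ht0 : 0 < t := div_pos hua hcon
      have h1 := hfS _ (hst a ha (t • c)
        (by simpa [← mul_assoc] using mul_nonpos_of_nonneg_of_nonpos (mul_nonneg ht0.le ht0.le) hc)
        (by simpa using mul_nonneg ht0.le hc'))
      rw [map_add, map_smul, smul_eq_mul, ht, div_mul_cancel₀ _ hcon.ne'] at h1
      linarith
    obtain ⟨hv, hv'⟩ := mem_closed_cone_of_dual hfc
    set e : Mink d := EuclideanSpace.single (Fin.last d) (1 : ℝ)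
    have he := hyp_subset_future (single_last_mem_hyp d)
    obtain ⟨m, -, hm⟩ := hmax e he
    set δ := (f p - u) / (|mink m e - mink p e| + 1) with hδ
    have hden : 0 < |mink m e - mink p e| + 1 := by positivity
    -- The choice of δ makes δ|⟨m, e⟩ - ⟨p, e⟩| < f p - u, so that the tilted half-space still
    -- contains `S` and still excludes p.
    have hδ0 : 0 < δ := div_pos (sub_pos.2 hfp) hden
    have hδ1 : δ * (|mink m e - mink p e| + 1) = f p - u := div_mul_cancel₀ _ hden.ne'
    have hη : sharp f + δ • e ∈ future d := add_mem_future hv hv' (smul_mem_future hδ0 he)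
    have hval : ∀ z, mink z (sharp f + δ • e) = f z + δ * mink z e := fun z => by
      rw [map_add, map_smul, smul_eq_mul, mink_comm z (sharp f), mink_sharp]
    have h2 := hp (sharp f + δ • e, u + δ * mink m e) ⟨hη, fun k hk => by
      rw [hval]
      have h3 := mul_le_mul_of_nonneg_left (hm k hk) hδ0.le
      linarith [hfS k hk]⟩
    dsimp only at h2
    rw [hval] at h2
    have h4 := mul_le_mul_of_nonneg_left (le_abs_self (mink m e - mink p e)) hδ0.le
    linarith

theorem hypBall_subset_future : hypBall d ⊆ future d := fun _ hx => ⟨by linarith [hx.1], hx.2⟩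

theorem hyp_subset_hypBall : hyp d ⊆ hypBall d := fun _ hx => ⟨hx.1.le, hx.2⟩

theorem mink_le_neg_lorNorm_of_hypBall {b x : Mink d} (hb : b ∈ hypBall d) (hx : x ∈ future d) :
    mink b x ≤ -lorNorm x := by
  have := mink_le_neg_of_sq_le (a := 1) (b := lorNorm x) (by linarith [hb.1]) hb.2.le
    (by rw [lorNorm_sq hx, neg_neg]) hx.2.le
  linarith

theorem mink_radial_self {x : Mink d} (hx : x ∈ future d) : mink (radial x) x = -lorNorm x := by
  conv_lhs => rw [← lorNorm_smul_radial hx]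
  rw [map_smul, radial_smul (lorNorm_pos hx), radial_radial hx, (radial_mem_hyp hx).1]
  simp

theorem convex_hypBall (d : ℕ) : Convex ℝ (hypBall d) := by
  intro x hx y hy a b ha hb hab
  have h1 := mink_le_neg_of_sq_le (a := 1) (b := 1) (by linarith [hx.1]) hx.2.le
    (by linarith [hy.1]) hy.2.le
  refine ⟨?_, (convex_future d (hypBall_subset_future hx) (hypBall_subset_future hy) ha hb hab).2⟩
  simp only [map_add, map_smul, LinearMap.add_apply, LinearMap.smul_apply, smul_eq_mul,
    mink_comm y x]
  have h2 := mul_le_mul_of_nonneg_left hx.1 (mul_nonneg ha ha)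
  have h3 := mul_le_mul_of_nonneg_left hy.1 (mul_nonneg hb hb)
  have h4 := mul_le_mul_of_nonneg_left h1 (mul_nonneg ha hb)
  have h5 : (a + b) ^ 2 = 1 := by rw [hab, one_pow]
  linarith

theorem add_mem_hypBall {b c : Mink d} (hb : b ∈ hypBall d) (hc : mink c c ≤ 0)
    (hc' : 0 ≤ c (Fin.last d)) : b + c ∈ hypBall d := by
  have h := mink_le_neg_of_sq_le (a := 1) (b := 0) (by linarith [hb.1]) hb.2.le
    (by simpa using hc) hc'
  refine ⟨?_, by simpa using add_pos_of_pos_of_nonneg hb.2 hc'⟩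
  simp only [map_add, LinearMap.add_apply, mink_comm c b]
  linarith [hb.1]

theorem isClosed_hypBall (d : ℕ) : IsClosed (hypBall d) := by
  have h : hypBall d = {x | mink x x ≤ -1} ∩ {x | 0 ≤ x (Fin.last d)} := by
    ext x
    refine ⟨fun hx => ⟨hx.1, hx.2.le⟩, fun hx => ⟨hx.1, lt_of_le_of_ne hx.2 fun h0 => ?_⟩⟩
    have h1 : mink x x ≤ -1 := hx.1
    rw [mink_self, ← h0] at h1
    linarith [sum_sq_castSucc_nonneg x]
  rw [h]
  exact (isClosed_le (contDiff_mink_self (n := 0)).continuous continuous_const).inter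
    (isClosed_le continuous_const (EuclideanSpace.proj (𝕜 := ℝ) (Fin.last d)).continuous)

theorem norm_le_of_hypBall {b : Mink d} (hb : b ∈ hypBall d) : ‖b‖ ≤ 2 * b (Fin.last d) := by
  refine le_of_sq_le_sq ?_ (by linarith [hb.2])
  rw [EuclideanSpace.real_norm_sq_eq, Fin.sum_univ_castSucc]
  have h := hb.1
  rw [mink_self] at h
  nlinarith [hb.2]

section

variable {K : Set (Mink d)}

/-- Both summands are unbounded, but a bounded sum forces bounded terms: the support plane of normal
`e` bounds the last coordinate of the points of `K` from below, hence that of the points of `hypBall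
d` from above, and this controls their norm. A subsequence then converges. -/
theorem IsFConvex.isClosed_add_smul_hypBall (hK : IsFConvex K) {ε : ℝ} (hε : 0 < ε) :
    IsClosed (K + ε • hypBall d) := by
  refine isSeqClosed_iff_isClosed.1 fun x p hx hxp => ?_
  choose k hk b' hb' hkb using fun n => Set.mem_add.1 (hx n)
  choose b hb hbb using fun n => Set.mem_smul_set.1 (hb' n)
  have he := hyp_subset_future (single_last_mem_hyp d)
  set e : Mink d := EuclideanSpace.single (Fin.last d) (1 : ℝ) with hedef
  have hlast : ∀ z : Mink d, mink z e = -z (Fin.last d) := fun z => by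
    simp [hedef, mink_apply, Fin.castSucc_ne_last]
  have hsum : ∀ n, x n = k n + ε • b n := fun n => by rw [hbb, hkb]
  obtain ⟨C, hC⟩ := (Metric.isBounded_range_of_tendsto x hxp).exists_norm_le
  have hbound : ∀ n, b n ∈ Metric.closedBall (0 : Mink d) (2 * ((C + supp K e) / ε)) := fun n => by
    rw [mem_closedBall_zero_iff]
    refine (norm_le_of_hypBall (hb n)).trans ?_
    have h1 := hK.le_supp he (hk n)
    rw [hlast] at h1
    have h2 : x n (Fin.last d) = k n (Fin.last d) + ε * b n (Fin.last d) := by rw [hsum]; simp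
    have h3 : x n (Fin.last d) ≤ C :=
      (le_abs_self _).trans ((PiLp.norm_apply_le (x n) (Fin.last d)).trans (hC _ ⟨n, rfl⟩))
    have h4 : b n (Fin.last d) ≤ (C + supp K e) / ε := by
      rw [le_div_iff₀ hε]
      linarith
    linarith
  obtain ⟨q, hq, φ, hφ, hlim⟩ := ((isCompact_closedBall (0 : Mink d)
    (2 * ((C + supp K e) / ε))).inter_right (isClosed_hypBall d)).tendsto_subseq
    fun n => ⟨hbound n, hb n⟩
  have hklim : Filter.Tendsto (fun n => k (φ n)) Filter.atTop (nhds (p - ε • q)) := by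
    have h1 := (hxp.comp hφ.tendsto_atTop).sub (hlim.const_smul ε)
    refine h1.congr fun n => ?_
    simp [hsum]
  have hkp := hK.isClosed.mem_of_tendsto hklim (Filter.Eventually.of_forall fun n => hk (φ n))
  exact Set.mem_add.2 ⟨_, hkp, _, Set.smul_mem_smul_set hq.2, sub_add_cancel _ _⟩

/-- On `hypBall d` the form ⟨·, x⟩ has maximum `-lorNorm x`, reached at `radial x`, by the reversed
Cauchy-Schwarz inequality. -/
theorem IsFConvex.exists_max_add_smul_hypBall (hK : IsFConvex K) {ε : ℝ} (hε : 0 < ε)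
    {x : Mink d} (hx : x ∈ future d) :
    ∃ k ∈ K + ε • hypBall d, mink k x = supp K x - ε * lorNorm x ∧
      ∀ k' ∈ K + ε • hypBall d, mink k' x ≤ mink k x := by
  obtain ⟨k, hk, h1, h2⟩ := hK.exists_supp hx
  have hval : mink (k + ε • radial x) x = supp K x - ε * lorNorm x := by
    rw [map_add, LinearMap.add_apply, map_smul, LinearMap.smul_apply, h1, mink_radial_self hx,
      smul_eq_mul]
    ring
  refine ⟨_, Set.add_mem_add hk (Set.smul_mem_smul_set
    (hyp_subset_hypBall (radial_mem_hyp hx))), hval, ?_⟩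
  rintro _ ⟨k', hk', _, ⟨b, hb, rfl⟩, rfl⟩
  have h3 := mul_le_mul_of_nonneg_left (mink_le_neg_lorNorm_of_hypBall hb hx) hε.le
  simp only [map_add, LinearMap.add_apply, map_smul, LinearMap.smul_apply, smul_eq_mul] at hval ⊢
  linarith [h2 k' hk']

theorem IsFConvex.add_smul_hypBall (hK : IsFConvex K) {ε : ℝ} (hε : 0 < ε) :
    IsFConvex (K + ε • hypBall d) := by
  refine isFConvex_of_stable (hK.isClosed_add_smul_hypBall hε)
    (hK.convex.add ((convex_hypBall d).smul ε)) ?_ ?_ fun x hx => ?_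
  · obtain ⟨k, hk, -⟩ := hK.exists_max_add_smul_hypBall hε
      (hyp_subset_future (single_last_mem_hyp d))
    exact ⟨k, hk⟩
  · rintro _ ⟨k, hk, _, ⟨b, hb, rfl⟩, rfl⟩ c hc hc'
    -- The future vector c is absorbed by the summand `ε • hypBall d`.
    refine Set.mem_add.2 ⟨k, hk, ε • (b + ε⁻¹ • c), Set.smul_mem_smul_set
      (add_mem_hypBall hb ?_ ?_), ?_⟩
    · have h := mul_nonneg (inv_pos.2 hε).le (inv_pos.2 hε).le
      have := mul_nonpos_of_nonneg_of_nonpos h hc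
      simpa only [map_smul, LinearMap.smul_apply, smul_eq_mul, ← mul_assoc] using this
    · simpa using mul_nonneg (inv_pos.2 hε).le hc'
    · rw [smul_add, smul_inv_smul₀ hε.ne', add_assoc]
  · obtain ⟨k, hk, -, h⟩ := hK.exists_max_add_smul_hypBall hε hx
    exact ⟨k, hk, h⟩

theorem IsFConvex.supp_add_smul_hypBall (hK : IsFConvex K) {ε : ℝ} (hε : 0 < ε)
    {x : Mink d} (hx : x ∈ future d) :
    supp (K + ε • hypBall d) x = supp K x - ε * lorNorm x := by
  obtain ⟨k, hk, h, h'⟩ := hK.exists_max_add_smul_hypBall hε hx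
  rw [supp_eq_of_forall_le hk h', h]

theorem IsFConvex.contDiffOn_supp_add (hK : IsFConvex K) (hh : ContDiffOn ℝ 2 (supp K) (hyp d))
    {ε : ℝ} (hε : 0 < ε) : ContDiffOn ℝ 2 (supp (K + ε • hypBall d)) (hyp d) :=
  (hh.sub (contDiffOn_const (c := ε))).congr fun x hx => by
    rw [hK.supp_add_smul_hypBall hε (hyp_subset_future hx), lorNorm_of_hyp hx, mul_one]

/-- The gradient of `H - ε lorNorm` is χ + ε `radial`, whose differential at η exceeds that of χ by
ε times the identity on tangent vectors. -/
theorem IsFConvex.tangentPos_add (hK : IsFConvex K) (hh : ContDiffOn ℝ 2 (supp K) (hyp d))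
    {ε : ℝ} (hε : 0 < ε) : TangentPos (oneExt (supp (K + ε • hypBall d))) := by
  have hH := contDiffOn_oneExt hh
  have hfun : ∀ x ∈ future d, oneExt (supp (K + ε • hypBall d)) x =
      oneExt (supp K) x - ε * lorNorm x := fun x hx => by
    rw [(hK.add_smul_hypBall hε).oneExt_supp hx, hK.oneExt_supp hx,
      hK.supp_add_smul_hypBall hε hx]
  have hgrad : ∀ x ∈ future d, lorGrad (oneExt (supp (K + ε • hypBall d))) x =
      lorGrad (oneExt (supp K)) x + ε • radial x := fun x hx => by
    have h1 := ((differentiableAt_of_future hH hx).hasFDerivAt.sub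
      ((hasFDerivAt_lorNorm hx).const_mul ε)).congr_of_eventuallyEq
        (f₁ := oneExt (supp (K + ε • hypBall d)))
        (by filter_upwards [future_mem_nhds hx] with y hy using hfun y hy)
    refine mink_ext fun z => ?_
    rw [mink_lorGrad, h1.fderiv, map_add, LinearMap.add_apply, map_smul, LinearMap.smul_apply,
      mink_lorGrad]
    change fderiv ℝ (oneExt (supp K)) x z - ε * -mink (radial x) z = _
    rw [smul_eq_mul]
    ring
  intro η hη v hv h0
  have hf := hyp_subset_future hη
  have h1 := ((hasFDerivAt_lorGrad hH hf).add
    ((hasFDerivAt_radial_of_hyp hη).const_smul ε)).congr_of_eventuallyEq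
      (f₁ := lorGrad (oneExt (supp (K + ε • hypBall d))))
      (by filter_upwards [future_mem_nhds hf] with y hy using hgrad y hy)
  rw [h1.fderiv]
  change 0 < mink (fderiv ℝ (lorGrad (oneExt (supp K))) η v + ε • (v + mink η v • η)) v
  rw [hv, zero_smul, add_zero, map_add, LinearMap.add_apply, map_smul, LinearMap.smul_apply]
  exact add_pos_of_nonneg_of_pos (hK.tangentNonneg hh η hη v hv)
    (mul_pos hε (mink_self_pos_of_orthogonal hf hv h0))

end

end FConvex

end

theorem mainTheorem11 (d : ℕ) (hd : 1 ≤ d) :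
    -- a given F-convex set `K`, with support function `supp K`
    (∀ K : Set (Mink d), IsFConvex K →
      -- `C²` support function: the radii are real and non-negative
      (ContDiffOn ℝ 2 (supp K) (hyp d) →
        ∀ η : hyp d, ∀ r ∈ principalRadii (supp K) η, r.im = 0 ∧ 0 ≤ r.re) ∧
      -- a `C²₊` set has a `C²` support function with positive radii, the inverses of the curvatures
      (IsC2Plus K →
        ContDiffOn ℝ 2 (supp K) (hyp d) ∧
        (∀ η : hyp d, ∀ r ∈ principalRadii (supp K) η, r.im = 0 ∧ 0 < r.re) ∧
        ∀ k : sBoundary K,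
          principalRadii (supp K) (normal K k) = (principalCurvatures K k).map (fun c => c⁻¹)) ∧
      -- `C²` support function with positive radii
      (ContDiffOn ℝ 2 (supp K) (hyp d) →
        (∀ η : hyp d, ∀ r ∈ principalRadii (supp K) η, r.im = 0 ∧ 0 < r.re) → IsC2Plus K) ∧
      -- `C²` support function with `∇²h - hg > 0`
      (ContDiffOn ℝ 2 (supp K) (hyp d) → HessPos (supp K) → IsC2Plus K) ∧
      -- the sum with `ε B`
      (ContDiffOn ℝ 2 (supp K) (hyp d) → ∀ ε : ℝ, 0 < ε →
        IsFConvex (K + ε • hypBall d) ∧ IsC2Plus (K + ε • hypBall d))) ∧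
    -- a given `C²` function `h` with `∇²h - hg ≥ 0`, or `> 0`
    (∀ h : Mink d → ℝ, ContDiffOn ℝ 2 h (hyp d) →
      (HessNonneg h → ∃ K : Set (Mink d), IsFConvex K ∧ Set.EqOn (supp K) h (hyp d)) ∧
      (HessPos h →
        ∃ K : Set (Mink d), IsFConvex K ∧ IsC2Plus K ∧ Set.EqOn (supp K) h (hyp d))) := by
  refine ⟨fun K hK => ⟨fun hh => radii_nonneg hh (hK.tangentNonneg hh), fun hC =>
    ⟨hC.contDiffOn_supp hK, hC.radii_pos hK, fun k => (hC.radii_eq hK k).2⟩,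
    fun hh hr => hK.isC2Plus hh (tangentPos_of_radii_pos hh hr),
    fun hh hp => hK.isC2Plus hh (tangentPos_of_hessPos hh hp),
    fun hh ε hε => ⟨hK.add_smul_hypBall hε, (hK.add_smul_hypBall hε).isC2Plus
      (hK.contDiffOn_supp_add hh hε) (hK.tangentPos_add hh hε)⟩⟩, fun h hh => ⟨fun hn => ?_,
    fun hp => ?_⟩⟩
  · have hn := tangentNonneg_of_hessNonneg hh hn
    exact ⟨wulff h, isFConvex_wulff hh hn, supp_wulff hh hn⟩
  · have hpos := tangentPos_of_hessPos hh hp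
    have hK := isFConvex_wulff hh hpos.nonneg
    have heq := supp_wulff hh hpos.nonneg
    refine ⟨wulff h, hK, hK.isC2Plus (hh.congr heq) (hpos.congr fun x hx => ?_), heq⟩
    rw [oneExt, oneExt, heq (radial_mem_hyp hx)]
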